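/- Let $A$ be a C*-algebra, let $\mathcal K$ be the C*-algebra of compact operators on $\ell^2(\mathbb N)$, and identify $A$ with the upper left corner of $A\otimes\mathcal K$. Let $(A\otimes\mathcal K)^\sim$ denote the unitization of $A\otimes\mathcal K$, and $A^+$ the set of positive elements of $A$. For $a,b\in A^+$ let $d_U(a,b)$ be the distance between the stable unitary orbits of $a$ and $b$: $$d_U(a,b)=\inf\{\|uau^*-vbv^*\| : u,v \text{ unitaries of } (A\otimes\mathcal K)^\sim\}.$$ Write $a\preccurlyeq_{Cu} b$ if there are $d_n\in A$, $n=1,2,\dots$, with $d_n^*bd_n\to a$; put $e_t(x)=\max(x-t,0)$, and $$d_W(a,b)=\inf\{r\ge 0 : e_{t+r}(a)\preccurlyeq_{Cu} e_t(b)\text{ and } e_{t+r}(b)\preccurlyeq_{Cu} e_t(a)\text{ for all } t\ge 0\}.$$ Suppose that $A$ has the following property (I): for all $x,e\in A$ with $e$ a positive contraction and $ex=xe=x$, there are unitaries $u_n\in(A\otimes\mathcal K)^\sim$, $n=1,2,\dots$, such that $u_n^*(x^*x+e)u_n\to xx^*+e$ in norm. Then: (i) If $a,b\in A^+$ and $r\in\mathbb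 R$ satisfy $d_W(a,b)<r$, then for every $\epsilon>0$ there is $b'\in A^+$ such that $\|a-b'\|<4r$ and $d_U(b,b')<\epsilon$. (ii) $A^+$ is complete with respect to the pseudometric $d_U$. -/

import Mathlib

open Filter Topology

universe u

noncomputable section

namespace CStarStab

/-! ### Finitely supported infinite matrices over a C⋆-algebra -/

section FinMatrix

/-- The infinite matrices over `A`, indexed by `ℕ × ℕ`, that vanish outside some corner
`{0, …, n - 1} × {0, …, n - 1}`. -/
def finMatrixSubmodule (A : Type u) [AddCommGroup A] [Module ℂ A] :
    Submodule ℂ (ℕ → ℕ → A) where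
  carrier := {x | ∃ n : ℕ, ∀ i j, n ≤ i ∨ n ≤ j → x i j = 0}
  zero_mem' := ⟨0, fun _ _ _ => rfl⟩
  add_mem' := by
    rintro x y ⟨n, hn⟩ ⟨m, hm⟩
    refine ⟨max n m, fun i j h => ?_⟩
    have h1 : n ≤ i ∨ n ≤ j := by omega
    have h2 : m ≤ i ∨ m ≤ j := by omega
    simp [hn i j h1, hm i j h2]
  smul_mem' := by
    rintro c x ⟨n, hn⟩
    exact ⟨n, fun i j h => by simp [hn i j h]⟩

/-- `M_∞(A) = ⋃ₙ Mₙ(A)`: finitely supported infinite matrices over `A`. -/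
def FinMatrix (A : Type u) [AddCommGroup A] [Module ℂ A] : Type u :=
  finMatrixSubmodule A

namespace FinMatrix

section Algebraic

variable {A : Type u} [AddCommGroup A] [Module ℂ A]

instance : AddCommGroup (FinMatrix A) := inferInstanceAs (AddCommGroup (finMatrixSubmodule A))
instance : Module ℂ (FinMatrix A) := inferInstanceAs (Module ℂ (finMatrixSubmodule A))

/-- The `(i, j)` entry. -/
def entry (x : FinMatrix A) (i j : ℕ) : A := x.1 i j

/-- `x` is supported in the upper left `n × n` corner. -/
def SupportedIn (x : FinMatrix A) (n : ℕ) : Prop := ∀ i j, n ≤ i ∨ n ≤ j → x.entry i j = 0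

/-- Constructor from entries. -/
def mk (f : ℕ → ℕ → A) (n : ℕ) (h : ∀ i j, n ≤ i ∨ n ≤ j → f i j = 0) : FinMatrix A :=
  ⟨f, n, h⟩

@[simp] lemma entry_mk (f : ℕ → ℕ → A) (n : ℕ) (h) (i j : ℕ) : (mk f n h).entry i j = f i j := rfl
@[simp] lemma entry_zero (i j : ℕ) : (0 : FinMatrix A).entry i j = 0 := rfl
@[simp] lemma entry_add (x y : FinMatrix A) (i j : ℕ) :
    (x + y).entry i j = x.entry i j + y.entry i j := rfl
@[simp] lemma entry_smul (c : ℂ) (x : FinMatrix A) (i j : ℕ) :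
    (c • x).entry i j = c • x.entry i j := rfl

lemma ext {x y : FinMatrix A} (h : ∀ i j, x.entry i j = y.entry i j) : x = y :=
  Subtype.ext (funext fun i => funext fun j => h i j)

lemma SupportedIn.mono {x : FinMatrix A} {n m : ℕ} (h : x.SupportedIn n) (hnm : n ≤ m) :
    x.SupportedIn m := fun i j hij => h i j (by omega)

lemma exists_supportedIn (x : FinMatrix A) : ∃ n, x.SupportedIn n := x.2

/-- The size of the least corner that contains the support. -/
def size (x : FinMatrix A) : ℕ := sInf {n | x.SupportedIn n}

lemma supportedIn_size (x : FinMatrix A) : x.SupportedIn x.size :=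
  Nat.sInf_mem (s := {n | x.SupportedIn n}) x.exists_supportedIn

lemma eventually_supportedIn (x : FinMatrix A) : ∀ᶠ n in atTop, x.SupportedIn n :=
  (eventually_ge_atTop x.size).mono fun _ hn => x.supportedIn_size.mono hn

/-- The upper left `n × n` corner of `x`, as an element of `Mₙ(A)`. -/
def cut (n : ℕ) (x : FinMatrix A) : CStarMatrix (Fin n) (Fin n) A :=
  CStarMatrix.ofMatrix fun i j => x.entry i j

@[simp] lemma cut_apply (n : ℕ) (x : FinMatrix A) (i j : Fin n) : x.cut n i j = x.entry i j := rfl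

@[simp] lemma cut_zero (n : ℕ) : (0 : FinMatrix A).cut n = 0 := rfl
@[simp] lemma cut_add (n : ℕ) (x y : FinMatrix A) : (x + y).cut n = x.cut n + y.cut n := rfl
@[simp] lemma cut_smul (n : ℕ) (c : ℂ) (x : FinMatrix A) : (c • x).cut n = c • x.cut n := rfl

lemma ext_cut {x y : FinMatrix A} (h : ∀ᶠ n in atTop, x.cut n = y.cut n) : x = y := by
  refine ext fun i j => ?_
  obtain ⟨n, hn, hi, hj⟩ :=
    (h.and ((eventually_gt_atTop i).and (eventually_gt_atTop j))).exists
  exact congrArg (fun M : CStarMatrix (Fin n) (Fin n) A => M ⟨i, hi⟩ ⟨j, hj⟩) hn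

end Algebraic

section Star

variable {A : Type u} [NonUnitalCStarAlgebra A]

/-- Matrix multiplication. -/
instance : Mul (FinMatrix A) where
  mul x y := mk (fun i j => ∑ k ∈ Finset.range (max x.size y.size), x.entry i k * y.entry k j)
    (max x.size y.size) (by
      intro i j h
      refine Finset.sum_eq_zero fun k _ => ?_
      rcases h with h | h
      · rw [x.supportedIn_size i k (Or.inl (le_trans (le_max_left _ _) h)), zero_mul]
      · rw [y.supportedIn_size k j (Or.inr (le_trans (le_max_right _ _) h)), mul_zero])

/-- The conjugate transpose. -/
instance : Star (FinMatrix A) where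
  star x := mk (fun i j => star (x.entry j i)) x.size (by
      intro i j h
      rw [x.supportedIn_size j i h.symm, star_zero])

lemma entry_star (x : FinMatrix A) (i j : ℕ) : (star x).entry i j = star (x.entry j i) := rfl

lemma entry_mul (x y : FinMatrix A) {n : ℕ} (hx : x.SupportedIn n) (i j : ℕ) :
    (x * y).entry i j = ∑ k ∈ Finset.range n, x.entry i k * y.entry k j := by
  have h1 : (x * y).entry i j =
    ∑ k ∈ Finset.range (max x.size y.size), x.entry i k * y.entry k j := rfl
  have key : ∀ m, x.SupportedIn m →
      ∑ k ∈ Finset.range m, x.entry i k * y.entry k j =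
        ∑ k ∈ Finset.range (max m n), x.entry i k * y.entry k j := by
    intro m hm
    refine Finset.sum_subset (by simp) fun k _ hk => ?_
    rw [hm i k (Or.inr (by simpa using hk)), zero_mul]
  have key' : ∑ k ∈ Finset.range n, x.entry i k * y.entry k j =
        ∑ k ∈ Finset.range (max (max x.size y.size) n), x.entry i k * y.entry k j := by
    refine Finset.sum_subset (by simp) fun k _ hk => ?_
    rw [hx i k (Or.inr (by simpa using hk)), zero_mul]
  rw [h1, key _ (x.supportedIn_size.mono (le_max_left _ _)), key']

@[simp] lemma cut_star (n : ℕ) (x : FinMatrix A) : (star x).cut n = star (x.cut n) := rfl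

lemma cut_mul {n : ℕ} {x : FinMatrix A} (hx : x.SupportedIn n) (y : FinMatrix A) :
    (x * y).cut n = x.cut n * y.cut n := by
  ext i j
  rw [CStarMatrix.mul_apply, cut_apply, entry_mul x y hx, Finset.sum_range]
  rfl

instance : NonUnitalRing (FinMatrix A) where
  left_distrib x y z := ext_cut (by
    filter_upwards [x.eventually_supportedIn] with n hx
    simp [cut_mul hx, mul_add])
  right_distrib x y z := ext_cut (by
    filter_upwards [x.eventually_supportedIn, y.eventually_supportedIn,
      (x + y).eventually_supportedIn] with n hx hy hxy
    simp [cut_mul hx, cut_mul hy, cut_mul hxy, add_mul])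
  zero_mul x := ext_cut (by
    filter_upwards [(0 : FinMatrix A).eventually_supportedIn] with n hx
    simp [cut_mul hx])
  mul_zero x := ext_cut (by
    filter_upwards [x.eventually_supportedIn] with n hx
    simp [cut_mul hx])
  mul_assoc x y z := ext_cut (by
    filter_upwards [x.eventually_supportedIn, y.eventually_supportedIn,
      (x * y).eventually_supportedIn] with n hx hy hxy
    simp [cut_mul hx, cut_mul hy, cut_mul hxy, mul_assoc])

instance : StarRing (FinMatrix A) where
  star_involutive x := ext fun i j => by simp [entry_star]
  star_add x y := ext fun i j => by simp [entry_star]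
  star_mul x y := ext_cut (by
    filter_upwards [x.eventually_supportedIn, (star y).eventually_supportedIn] with n hx hy
    simp [cut_mul hx, cut_mul hy])

instance : StarModule ℂ (FinMatrix A) where
  star_smul c x := ext fun i j => by simp [entry_star]

instance : IsScalarTower ℂ (FinMatrix A) (FinMatrix A) where
  smul_assoc c x y := ext_cut (by
    filter_upwards [x.eventually_supportedIn, (c • x).eventually_supportedIn] with n hx hcx
    simp only [smul_eq_mul, cut_mul hx, cut_mul hcx, cut_smul]
    ext i j
    simp [CStarMatrix.mul_apply, Finset.smul_sum, smul_mul_assoc])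

instance : SMulCommClass ℂ (FinMatrix A) (FinMatrix A) where
  smul_comm c x y := ext_cut (by
    filter_upwards [x.eventually_supportedIn] with n hx
    simp only [smul_eq_mul, cut_mul hx, cut_smul]
    ext i j
    simp [CStarMatrix.mul_apply, Finset.smul_sum, mul_smul_comm])

/-- Padding an `n × n` matrix with zeros to an `m × m` matrix. -/
def padFun {n : ℕ} (m : ℕ) (M : CStarMatrix (Fin n) (Fin n) A) : CStarMatrix (Fin m) (Fin m) A :=
  CStarMatrix.ofMatrix fun i j =>
    if hij : (i : ℕ) < n ∧ (j : ℕ) < n then M ⟨i, hij.1⟩ ⟨j, hij.2⟩ else 0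

lemma padFun_apply {n m : ℕ} (M : CStarMatrix (Fin n) (Fin n) A) (i j : Fin m) :
    padFun m M i j = if hij : (i : ℕ) < n ∧ (j : ℕ) < n then M ⟨i, hij.1⟩ ⟨j, hij.2⟩ else 0 := rfl

/-- The corner embedding `Mₙ(A) → Mₘ(A)` for `n ≤ m`, padding with zeros. -/
def pad {n m : ℕ} (h : n ≤ m) :
    CStarMatrix (Fin n) (Fin n) A →⋆ₙₐ[ℂ] CStarMatrix (Fin m) (Fin m) A where
  toFun M := padFun m M
  map_smul' c M := by
    ext i j
    simp only [padFun_apply, CStarMatrix.smul_apply]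
    split_ifs <;> simp
  map_zero' := by
    ext i j
    simp [padFun_apply]
  map_add' M N := by
    ext i j
    simp only [padFun_apply, CStarMatrix.add_apply]
    split_ifs <;> simp
  map_mul' M N := by
    ext i j
    obtain ⟨d, rfl⟩ := Nat.exists_eq_add_of_le h
    simp only [padFun_apply, CStarMatrix.mul_apply]
    rw [Fin.sum_univ_add]
    by_cases hi : (i : ℕ) < n <;> by_cases hj : (j : ℕ) < n <;> simp [hi, hj]
  map_star' M := by
    ext i j
    simp only [padFun_apply, CStarMatrix.star_apply]
    by_cases hi : (i : ℕ) < n <;> by_cases hj : (j : ℕ) < n <;> simp [hi, hj]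

@[simp] lemma pad_apply {n m : ℕ} (h : n ≤ m) (M : CStarMatrix (Fin n) (Fin n) A) (i j : Fin m) :
    pad h M i j =
      if hij : (i : ℕ) < n ∧ (j : ℕ) < n then M ⟨i, hij.1⟩ ⟨j, hij.2⟩ else 0 := rfl

lemma pad_injective {n m : ℕ} (h : n ≤ m) : Function.Injective (pad (A := A) h) := by
  intro M N hMN
  ext i j
  have := congrArg (fun K : CStarMatrix (Fin m) (Fin m) A => K (Fin.castLE h i) (Fin.castLE h j))
    hMN
  simpa using this

lemma cut_eq_pad {n m : ℕ} (h : n ≤ m) {x : FinMatrix A} (hx : x.SupportedIn n) :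
    x.cut m = pad h (x.cut n) := by
  ext i j
  by_cases hij : (i : ℕ) < n ∧ (j : ℕ) < n
  · simp [hij]
  · have : n ≤ (i : ℕ) ∨ n ≤ (j : ℕ) := by omega
    simp [hij, hx i j this]

end Star

section Norm

variable {A : Type u} [NonUnitalCStarAlgebra A] [PartialOrder A] [StarOrderedRing A]

/-- The C⋆-norm of `Mₙ(A)`, for the least `n` whose corner contains the support (any larger `n`
gives the same value). -/
instance : Norm (FinMatrix A) where
  norm x := ‖x.cut x.size‖

lemma norm_eq {n : ℕ} {x : FinMatrix A} (hx : x.SupportedIn n) : ‖x‖ = ‖x.cut n‖ := by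
  have h : x.size ≤ n := Nat.sInf_le hx
  rw [cut_eq_pad h x.supportedIn_size,
    NonUnitalStarAlgHom.norm_map (pad (A := A) h) (pad_injective h)]
  rfl

lemma normedSpaceCore : NormedSpace.Core ℂ (FinMatrix A) where
  norm_nonneg x := norm_nonneg (x.cut x.size)
  norm_smul c x := by
    obtain ⟨n, hx, hcx⟩ :=
      (x.eventually_supportedIn.and (c • x).eventually_supportedIn).exists
    rw [norm_eq hx, norm_eq hcx, cut_smul, norm_smul]
  norm_triangle x y := by
    obtain ⟨n, hx, hy, hxy⟩ :=
      (x.eventually_supportedIn.and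
        (y.eventually_supportedIn.and (x + y).eventually_supportedIn)).exists
    rw [norm_eq hx, norm_eq hy, norm_eq hxy, cut_add]
    exact norm_add_le _ _
  norm_eq_zero_iff x := by
    constructor
    · intro h
      refine ext_cut ?_
      filter_upwards [x.eventually_supportedIn] with n hx
      rw [norm_eq hx, norm_eq_zero] at h
      rw [h, cut_zero]
    · rintro rfl
      obtain ⟨n, hn⟩ := (0 : FinMatrix A).exists_supportedIn
      rw [norm_eq hn, cut_zero, norm_zero]

instance : NormedAddCommGroup (FinMatrix A) := NormedAddCommGroup.ofCore normedSpaceCore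

instance : NormedSpace ℂ (FinMatrix A) := NormedSpace.ofCore normedSpaceCore

instance : NonUnitalNormedRing (FinMatrix A) where
  __ := (inferInstance : NormedAddCommGroup (FinMatrix A))
  __ := (inferInstance : NonUnitalRing (FinMatrix A))
  norm_mul_le x y := by
    obtain ⟨n, hx, hy, hxy⟩ :=
      (x.eventually_supportedIn.and
        (y.eventually_supportedIn.and (x * y).eventually_supportedIn)).exists
    rw [norm_eq hx, norm_eq hy, norm_eq hxy, cut_mul hx]
    exact norm_mul_le _ _

instance : CStarRing (FinMatrix A) where
  norm_mul_self_le x := by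
    obtain ⟨n, hx, hsx, hxx⟩ :=
      (x.eventually_supportedIn.and
        ((star x).eventually_supportedIn.and (star x * x).eventually_supportedIn)).exists
    rw [norm_eq hx, norm_eq hxx, cut_mul hsx, cut_star, CStarRing.norm_star_mul_self]

end Norm

end FinMatrix

end FinMatrix

/-! ### The stabilization `A ⊗ K` -/

section Stabilization

open UniformSpace

variable (A : Type u) [NonUnitalCStarAlgebra A] [PartialOrder A] [StarOrderedRing A]

/-- The stabilization `A ⊗ K` (`K` the compact operators on `ℓ²(ℕ)`): the completion of
`⋃ₙ Mₙ(A)` in its C⋆-norm. -/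
abbrev Stabilization : Type u := Completion (FinMatrix A)

namespace Stabilization

variable {A}

instance : Mul (Stabilization A) where
  mul := Function.curry <| (Completion.isDenseInducing_coe.prodMap
    Completion.isDenseInducing_coe).extend
      ((fun x : FinMatrix A => (x : Stabilization A)) ∘ Function.uncurry (· * ·))

lemma coe_mul (x y : FinMatrix A) : ((x * y : FinMatrix A) : Stabilization A) = x * y :=
  ((Completion.isDenseInducing_coe.prodMap Completion.isDenseInducing_coe).extend_eq
    ((Completion.continuous_coe (FinMatrix A)).comp continuous_mul) (x, y)).symm

instance : ContinuousMul (Stabilization A) where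
  continuous_mul := by
    let m := (AddMonoidHom.mul : FinMatrix A →+ FinMatrix A →+ FinMatrix A).compr₂
      Completion.toCompl
    have : Continuous fun p : FinMatrix A × FinMatrix A => m p.1 p.2 :=
      (Completion.continuous_coe _).comp continuous_mul
    have di : IsDenseInducing (Completion.toCompl : FinMatrix A → Stabilization A) :=
      Completion.isDenseInducing_coe
    exact (di.extend_Z_bilin di this :)

instance : Star (Stabilization A) where
  star := Completion.map star

lemma uniformContinuous_star : UniformContinuous (star : FinMatrix A → FinMatrix A) :=
  (starₗᵢ ℂ : FinMatrix A ≃ₗᵢ⋆[ℂ] FinMatrix A).isometry.uniformContinuous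

lemma coe_star (x : FinMatrix A) : ((star x : FinMatrix A) : Stabilization A) = star ↑x :=
  (Completion.map_coe uniformContinuous_star x).symm

instance : ContinuousStar (Stabilization A) where
  continuous_star := Completion.continuous_map

instance : NonUnitalRing (Stabilization A) where
  zero_mul a := Completion.induction_on a (isClosed_eq (by fun_prop) continuous_const)
    fun a => by rw [← Completion.coe_zero, ← coe_mul, zero_mul]
  mul_zero a := Completion.induction_on a (isClosed_eq (by fun_prop) continuous_const)
    fun a => by rw [← Completion.coe_zero, ← coe_mul, mul_zero]
  mul_assoc a b c := Completion.induction_on₃ a b c (isClosed_eq (by fun_prop) (by fun_prop))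
    fun a b c => by simp only [← coe_mul, mul_assoc]
  left_distrib a b c := Completion.induction_on₃ a b c (isClosed_eq (by fun_prop) (by fun_prop))
    fun a b c => by simp only [← coe_mul, ← Completion.coe_add, mul_add]
  right_distrib a b c := Completion.induction_on₃ a b c (isClosed_eq (by fun_prop) (by fun_prop))
    fun a b c => by simp only [← coe_mul, ← Completion.coe_add, add_mul]

instance : StarRing (Stabilization A) where
  star_involutive a := Completion.induction_on a (isClosed_eq (by fun_prop) (by fun_prop))
    fun a => by simp only [← coe_star, star_star]
  star_add a b := Completion.induction_on₂ a b (isClosed_eq (by fun_prop) (by fun_prop))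
    fun a b => by simp only [← coe_star, ← Completion.coe_add, star_add]
  star_mul a b := Completion.induction_on₂ a b (isClosed_eq (by fun_prop) (by fun_prop))
    fun a b => by simp only [← coe_star, ← coe_mul, star_mul]

instance : NonUnitalNormedRing (Stabilization A) where
  __ := (inferInstance : NormedAddCommGroup (Stabilization A))
  __ := (inferInstance : NonUnitalRing (Stabilization A))
  norm_mul_le a b := Completion.induction_on₂ a b (isClosed_le (by fun_prop) (by fun_prop))
    fun a b => by simpa only [← coe_mul, Completion.norm_coe] using norm_mul_le a b

lemma smul_mul_assoc' (c : ℂ) (a b : Stabilization A) : (c • a) * b = c • (a * b) :=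
  Completion.induction_on₂ a b
    (isClosed_eq ((continuous_fst.const_smul c).mul continuous_snd)
      ((continuous_fst.mul continuous_snd).const_smul c))
    fun a b => by
      rw [← Completion.coe_smul, ← coe_mul, ← coe_mul, ← Completion.coe_smul]
      exact congrArg _ (smul_mul_assoc c a b)

lemma mul_smul_comm' (c : ℂ) (a b : Stabilization A) : a * (c • b) = c • (a * b) :=
  Completion.induction_on₂ a b
    (isClosed_eq (continuous_fst.mul (continuous_snd.const_smul c))
      ((continuous_fst.mul continuous_snd).const_smul c))
    fun a b => by
      rw [← Completion.coe_smul, ← coe_mul, ← coe_mul, ← Completion.coe_smul]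
      exact congrArg _ (mul_smul_comm c a b)

lemma star_smul' (c : ℂ) (a : Stabilization A) : star (c • a) = star c • star a :=
  Completion.induction_on a
    (isClosed_eq (continuous_id.const_smul c).star (continuous_id.star.const_smul (star c)))
    fun a => by
      rw [← Completion.coe_smul, ← coe_star, ← coe_star, ← Completion.coe_smul]
      exact congrArg _ (star_smul c a)

lemma norm_mul_self_le' (a : Stabilization A) : ‖a‖ * ‖a‖ ≤ ‖star a * a‖ :=
  Completion.induction_on a (isClosed_le (by fun_prop) (by fun_prop))
    fun a => by
      rw [← coe_star, ← coe_mul, Completion.norm_coe, Completion.norm_coe]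
      exact CStarRing.norm_mul_self_le a

instance : CStarRing (Stabilization A) := ⟨norm_mul_self_le'⟩
instance : IsScalarTower ℂ (Stabilization A) (Stabilization A) := ⟨smul_mul_assoc'⟩
instance : SMulCommClass ℂ (Stabilization A) (Stabilization A) :=
  ⟨fun c a b => (mul_smul_comm' c a b).symm⟩
instance : StarModule ℂ (Stabilization A) := ⟨star_smul'⟩

/-- `A ⊗ K` is a C⋆-algebra. -/
instance : NonUnitalCStarAlgebra (Stabilization A) where

/-- The infinite matrix with `a` in the upper left corner and zeros elsewhere. -/
def cornerMatrix (a : A) : FinMatrix A :=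
  FinMatrix.mk (fun i j => if i = 0 ∧ j = 0 then a else 0) 1 (by
    intro i j h
    exact if_neg (by omega))

/-- The identification of `A` with the upper left corner of `A ⊗ K`. -/
def corner (a : A) : Stabilization A := (cornerMatrix a : FinMatrix A)

end Stabilization

end Stabilization

/-! ### Relations on positive elements and the two pseudometrics -/

section Relations

variable {A : Type u} [NonUnitalCStarAlgebra A]

/-- `(a - t)₊ = e_t(a)` for self-adjoint `a` and `t ≥ 0`. -/
def cutDown (t : ℝ) (a : A) : A := cfcₙ (fun x : ℝ => max (x - t) 0) a

/-- Cuntz comparison: `a` is Cuntz smaller than `b` if `dₙ⋆ b dₙ → a` for some `dₙ ∈ A`. -/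
def CuntzLE (a b : A) : Prop :=
  ∃ d : ℕ → A, Tendsto (fun n => star (d n) * b * d n) atTop (𝓝 a)

/-- The pseudometric `d_W`. -/
def dW (a b : A) : ℝ :=
  sInf {r : ℝ | 0 ≤ r ∧ ∀ t : ℝ, 0 ≤ t →
    CuntzLE (cutDown (t + r) a) (cutDown t b) ∧ CuntzLE (cutDown (t + r) b) (cutDown t a)}

variable [PartialOrder A] [StarOrderedRing A]

/-- The unitary group of `(A ⊗ K)~`, the unitization of `A ⊗ K`. -/
abbrev StableUnitary (A : Type u) [NonUnitalCStarAlgebra A] [PartialOrder A] [StarOrderedRing A] :=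
  unitary (Unitization ℂ (Stabilization A))

/-- `A` as a subset of `(A ⊗ K)~`, through the upper left corner of `A ⊗ K`. -/
def toStable (a : A) : Unitization ℂ (Stabilization A) :=
  ((Stabilization.corner a : Stabilization A) : Unitization ℂ (Stabilization A))

/-- Stable approximate unitary equivalence: `uₙ⋆ a uₙ → b` for some unitaries `uₙ` of `(A ⊗ K)~`. -/
def StablyApproxUnitarilyEquiv (a b : A) : Prop :=
  ∃ u : ℕ → StableUnitary A,
    Tendsto (fun n => star (u n : Unitization ℂ (Stabilization A)) * toStable a * u n)
      atTop (𝓝 (toStable b))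

/-- The property (I): for all `x, e ∈ A` with `e` a positive contraction and `ex = xe = x`, the
elements `x⋆x + e` and `xx⋆ + e` are stably approximately unitarily equivalent. -/
def PropertyI (A : Type u) [NonUnitalCStarAlgebra A] [PartialOrder A] [StarOrderedRing A] : Prop :=
  ∀ x e : A, 0 ≤ e → ‖e‖ ≤ 1 → e * x = x → x * e = x →
    StablyApproxUnitarilyEquiv (star x * x + e) (x * star x + e)

/-- The stable unitary orbit of `a`: all `u a u⋆` with `u` a unitary of `(A ⊗ K)~`. -/
def stableOrbit (a : A) : Set (Unitization ℂ (Stabilization A)) :=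
  Set.range fun u : StableUnitary A =>
    (u : Unitization ℂ (Stabilization A)) * toStable a * star (u : Unitization ℂ (Stabilization A))

/-- The pseudometric `d_U`: the distance between the stable unitary orbits of `a` and `b`. -/
def dU (a b : A) : ℝ :=
  sInf {r : ℝ | ∃ y ∈ stableOrbit a, ∃ z ∈ stableOrbit b, r = ‖y - z‖}

lemma toStable_mem_stableOrbit (a : A) : toStable a ∈ stableOrbit a :=
  ⟨1, by simp⟩

lemma conj_mem_stableOrbit {a : A} {y : Unitization ℂ (Stabilization A)} (hy : y ∈ stableOrbit a)
    (w : StableUnitary A) :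
    (w : Unitization ℂ (Stabilization A)) * y * star (w : Unitization ℂ (Stabilization A)) ∈
      stableOrbit a := by
  obtain ⟨u, rfl⟩ := hy
  exact ⟨w * u, by simp [mul_assoc]⟩

lemma dU_le {a b : A} {y z : Unitization ℂ (Stabilization A)} (hy : y ∈ stableOrbit a)
    (hz : z ∈ stableOrbit b) : dU a b ≤ ‖y - z‖ :=
  csInf_le ⟨0, by rintro _ ⟨y, -, z, -, rfl⟩; exact norm_nonneg _⟩ ⟨y, hy, z, hz, rfl⟩

lemma exists_lt_of_dU_lt {a b : A} {r : ℝ} (h : dU a b < r) :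
    ∃ y ∈ stableOrbit a, ∃ z ∈ stableOrbit b, ‖y - z‖ < r := by
  have hne : {r : ℝ | ∃ y ∈ stableOrbit a, ∃ z ∈ stableOrbit b, r = ‖y - z‖}.Nonempty :=
    ⟨_, toStable a, toStable_mem_stableOrbit a, toStable b, toStable_mem_stableOrbit b, rfl⟩
  obtain ⟨_, ⟨y, hy, z, hz, rfl⟩, hr⟩ := exists_lt_of_csInf_lt hne h
  exact ⟨y, hy, z, hz, hr⟩

lemma dU_self (a : A) : dU a a = 0 := by
  refine le_antisymm ?_ (Real.sInf_nonneg ?_)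
  · simpa using dU_le (toStable_mem_stableOrbit a) (toStable_mem_stableOrbit a)
  · rintro _ ⟨y, -, z, -, rfl⟩
    exact norm_nonneg _

lemma dU_comm (a b : A) : dU a b = dU b a := by
  have h : ∀ a b : A, dU a b ≤ dU b a := fun a b => le_of_forall_gt fun r hr => by
    obtain ⟨y, hy, z, hz, h⟩ := exists_lt_of_dU_lt hr
    exact (dU_le hz hy).trans_lt (by rwa [norm_sub_rev])
  exact le_antisymm (h a b) (h b a)

lemma dU_triangle (a b c : A) : dU a c ≤ dU a b + dU b c := by
  refine le_of_forall_pos_lt_add fun ε hε => ?_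
  obtain ⟨y, hy, z, hz, h1⟩ := exists_lt_of_dU_lt (show dU a b < dU a b + ε / 2 by linarith)
  obtain ⟨z', hz', v, hv, h2⟩ := exists_lt_of_dU_lt (show dU b c < dU b c + ε / 2 by linarith)
  obtain ⟨u, rfl⟩ := hz
  obtain ⟨u', rfl⟩ := hz'
  have h3 := dU_le hy (conj_mem_stableOrbit hv (u * star u'))
  set s := ((u * star u' : StableUnitary A) : Unitization ℂ (Stabilization A)) with hs
  set p := (u : Unitization ℂ (Stabilization A)) * toStable b *
    star (u : Unitization ℂ (Stabilization A)) with hp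
  set q := (u' : Unitization ℂ (Stabilization A)) * toStable b *
    star (u' : Unitization ℂ (Stabilization A)) with hq
  have h4 : s * q * star s = p := by
    have e : star (u' : Unitization ℂ (Stabilization A)) * u' = 1 := Unitary.coe_star_mul_self u'
    have e' : ∀ w, star (u' : Unitization ℂ (Stabilization A)) * (u' * w) = w := fun w => by
      rw [← mul_assoc, e, one_mul]
    simp only [hs, hp, hq, Submonoid.coe_mul, Unitary.coe_star, star_mul, star_star, mul_assoc, e']
  have h5 : p - s * v * star s = s * (q - v) * star s := by
    rw [← h4]; noncomm_ring
  have h6 : ‖p - s * v * star s‖ = ‖q - v‖ := by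
    rw [h5, mul_assoc, hs, CStarRing.norm_coe_unitary_mul, ← Unitary.coe_star,
      CStarRing.norm_mul_coe_unitary]
  have h7 := norm_sub_le_norm_sub_add_norm_sub y p (s * v * star s)
  linarith

/-- The set `A⁺` of positive elements of `A`, to be equipped with the pseudometric `d_U`. -/
def PositiveElements (A : Type u) [NonUnitalCStarAlgebra A] [PartialOrder A] : Type u :=
  {a : A // 0 ≤ a}

/-- The positive elements of `A` with the pseudometric `d_U`. -/
instance : PseudoMetricSpace (PositiveElements A) where
  dist a b := dU a.1 b.1
  dist_self a := dU_self a.1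
  dist_comm a b := dU_comm a.1 b.1
  dist_triangle a b c := dU_triangle a.1 b.1 c.1

end Relations

end CStarStab

end

open scoped CStarAlgebra

namespace CStarStab

/-! ### Continuous functional calculus in a unital C⋆-algebra. -/

section Calculus

variable {B : Type*} [CStarAlgebra B]

/-! Let `M` be the unitization of the stabilization and pass to bounded sequences in `M` modulo null
sequences, where approximate relations become exact. Functional calculus stays in the sequence
algebra and is only read modulo the kernel (`CStarKernel.cfc_eq`). Property (I) then says: if `h` is
a unit for `x` (and lies suitably under a sequence `e` from `A`), some unitary commuting with `h`
carries `x⋆x` to `xx⋆` (`FlipEmbedding.hasFlips`). The summand `e` in property (I) is what yields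
the commutation, because `(e + p - 1)₊ = p` when `ep = p` (`CStarKernel.cfc_posPart_add`), so a
unitary that moves the sum correctly moves each summand correctly.

Comparison of cut-downs gives elements `y` with `y⋆y = (b - t)₊` whose range lies where `a ≥ s`
(`CutDownLE`). Fix a mesh `g` slightly larger than the comparison constant. The goal is to conjugate
`a` and `b` until their spectral projections at multiples of `g` interlace, alternately one of `a`
and one of `b` (`exists_interlaced`). Above both norms this is trivial, and it is extended downwards
one level at a time. In one step (`exists_unitary_levelLE`), `y` pushes a level of `b` under the
next lower level of `a`, but it would destroy the levels already arranged. A first flip brings the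
upper level `p` back to its place; a second flip replaces the corrected map by a unitary, which
fixes `p` (`exists_unitary_of_two_levels`).

Interlacing gives `x ≤ z + 4g` and `z ≤ x + 4g` modulo the kernel, by comparing layers of thickness
`2g` (`exists_le_add_of_levelLE`); this is the source of the constant 4. All unitaries commute with
a sequence `e` from `A` that is a unit for `a` and `b`, so the conjugate of `b`, compressed by `e`,
returns to `A` because `A` is hereditary in `M` (`FlipEmbedding.exists_close_conj`).

For completeness, `‖uau⋆ - b‖ ≤ r` already gives the same comparison of cut-downs inside `M`
(`cutDownLE_of_norm_conj_sub_le`), so part (i) holds with `dU` in place of `dW`. A fast Cauchy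
sequence for `dU` can therefore be replaced, up to small `dU`-errors, by a norm Cauchy sequence in
`A`. -/

lemma cfc_eq_mul {a : B} {f g h : ℝ → ℝ} (hg : Continuous g) (hh : Continuous h)
    (H : ∀ x ∈ spectrum ℝ a, f x = g x * h x) : cfc f a = cfc g a * cfc h a := by
  rw [← cfc_mul g h a hg.continuousOn hh.continuousOn]
  exact cfc_congr H

lemma cfc_mul_eq_zero {a : B} {g h : ℝ → ℝ} (hg : Continuous g) (hh : Continuous h)
    (H : ∀ x ∈ spectrum ℝ a, g x * h x = 0) : cfc g a * cfc h a = 0 := by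
  rw [← cfc_eq_mul (f := fun _ => 0) hg hh fun x hx => (H x hx).symm]
  exact cfc_const_zero ℝ a

lemma one_sub_cfc {a : B} (ha : IsSelfAdjoint a) {f : ℝ → ℝ} (hf : Continuous f) :
    1 - cfc f a = cfc (fun x => 1 - f x) a := by
  rw [cfc_sub (fun _ => (1 : ℝ)) f a continuousOn_const hf.continuousOn, cfc_const_one ℝ a]

lemma cfc_comp_of_continuous {a : B} (ha : IsSelfAdjoint a) {f g : ℝ → ℝ} (hg : Continuous g)
    (hf : Continuous f) : cfc g (cfc f a) = cfc (fun x => g (f x)) a :=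
  (cfc_comp g f a ha hg.continuousOn hf.continuousOn).symm

lemma map_cfc_of_continuous {C : Type*} [CStarAlgebra C] (φ : B →⋆ₐ[ℂ] C) {a : B}
    (ha : IsSelfAdjoint a) {f : ℝ → ℝ} (hf : Continuous f) : φ (cfc f a) = cfc f (φ a) :=
  StarAlgHom.map_cfc (R := ℝ) (S := ℂ) φ f a hf.continuousOn
    (map_continuous φ) ha (ha.map φ)

lemma cfc_conj_unitary {u : B} (hu : u ∈ unitary B) {a : B} (ha : IsSelfAdjoint a) {f : ℝ → ℝ}
    (hf : Continuous f) : cfc f (u * a * star u) = u * cfc f a * star u :=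
  (map_cfc_of_continuous (Unitary.conjStarAlgAut ℂ B ⟨u, hu⟩ : B →⋆ₐ[ℂ] B) ha hf).symm

lemma isSelfAdjoint_conj {a : B} (ha : IsSelfAdjoint a) (u : B) :
    IsSelfAdjoint (u * a * star u) := by
  simpa using ha.conjugate u

lemma abs_le_norm_of_mem_spectrum {a : B} (ha : IsSelfAdjoint a) {x : ℝ}
    (hx : x ∈ spectrum ℝ a) : |x| ≤ ‖a‖ := by
  simpa using IsometricContinuousFunctionalCalculus.norm_spectrum_le (𝕜 := ℝ) a hx ha

lemma isSelfAdjoint_cfc {a : B} (f : ℝ → ℝ) : IsSelfAdjoint (cfc f a) := cfc_predicate f a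

end Calculus

/-! ### Calculus modulo a closed ideal. -/

/-- The kernel of the ring homomorphism `π` is a closed ideal, stable under the involution, modulo
which the C⋆-identity still detects zero. -/
structure CStarKernel {B Q : Type*} [CStarAlgebra B] [Ring Q] (π : B →+* Q) : Prop where
  closed : IsClosed {x | π x = 0}
  star_mem : ∀ x, π x = 0 → π (star x) = 0
  eq_zero_of_star_mul_self : ∀ x, π (star x * x) = 0 → π x = 0

namespace CStarKernel

variable {B Q : Type*} [CStarAlgebra B] [Ring Q] {π : B →+* Q}

lemma star_eq (hπ : CStarKernel π) {x y : B} (h : π x = π y) : π (star x) = π (star y) := by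
  have := hπ.star_mem (x - y) (by rw [map_sub, h, sub_self])
  rwa [star_sub, map_sub, sub_eq_zero] at this

lemma map_aeval_eq {a b : B} (h : π a = π b) (p : Polynomial ℝ) :
    π (Polynomial.aeval a p) = π (Polynomial.aeval b p) := by
  induction p using Polynomial.induction_on' with
  | add p q hp hq => simp only [map_add, hp, hq]
  | monomial n c => simp only [Polynomial.aeval_monomial, map_mul, map_pow, h]

/-- Functional calculus is well defined modulo the kernel. -/
lemma cfc_eq (hπ : CStarKernel π) {a b : B} (ha : IsSelfAdjoint a) (hb : IsSelfAdjoint b)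
    (h : π a = π b) {f : ℝ → ℝ} (hf : Continuous f) : π (cfc f a) = π (cfc f b) := by
  rw [← sub_eq_zero, ← map_sub]
  change cfc f a - cfc f b ∈ {x | π x = 0}
  rw [← hπ.closed.closure_eq, Metric.mem_closure_iff]
  intro ε hε
  set R := max ‖a‖ ‖b‖
  obtain ⟨p, hp⟩ := exists_polynomial_near_of_continuousOn (-R) R f hf.continuousOn (ε / 3)
    (by positivity)
  have key : ∀ c : B, IsSelfAdjoint c → ‖c‖ ≤ R → ‖cfc f c - Polynomial.aeval c p‖ ≤ ε / 3 := by
    intro c hc hcR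
    rw [← cfc_polynomial p c hc, ← cfc_sub f _ c hf.continuousOn p.continuous.continuousOn]
    refine norm_cfc_le (by positivity) fun x hx => ?_
    have := abs_le_norm_of_mem_spectrum hc hx
    rw [Real.norm_eq_abs, abs_sub_comm]
    exact (hp x (abs_le.mp (this.trans hcR))).le
  refine ⟨Polynomial.aeval a p - Polynomial.aeval b p, ?_, ?_⟩
  · simp [map_aeval_eq h p]
  · rw [dist_eq_norm]
    have e : cfc f a - cfc f b - (Polynomial.aeval a p - Polynomial.aeval b p) =
      (cfc f a - Polynomial.aeval a p) - (cfc f b - Polynomial.aeval b p) := by abel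
    rw [e]
    have := norm_sub_le (cfc f a - Polynomial.aeval a p) (cfc f b - Polynomial.aeval b p)
    have := key a ha (le_max_left _ _)
    have := key b hb (le_max_right _ _)
    linarith

/-- The hypothesis is the C⋆-identity for the adjoint of `x * c`, since `x c c⋆ x⋆ = (xc)(xc)⋆`. -/
lemma mul_eq_zero_of_sq (hπ : CStarKernel π) {x c : B}
    (h : π (x * (c * star c) * star x) = 0) : π (x * c) = 0 := by
  have h1 : π (star (x * c)) = 0 := by
    refine hπ.eq_zero_of_star_mul_self _ ?_
    rw [star_star, star_mul, ← h]
    simp only [mul_assoc]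
  simpa using hπ.star_mem _ h1

/-- A unitary which commutes with `x` modulo the kernel commutes with functions of `x`. -/
lemma commute_cfc (hπ : CStarKernel π) {v x : B} (hv : v ∈ unitary B) (hx : IsSelfAdjoint x)
    (h : π (v * x) = π (x * v)) {f : ℝ → ℝ} (hf : Continuous f) :
    π (v * cfc f x) = π (cfc f x * v) := by
  have h1 : π (v * x * star v) = π x := by
    rw [map_mul, h, ← map_mul, mul_assoc, (Unitary.mem_iff.mp hv).2, mul_one]
  have h2 := hπ.cfc_eq (isSelfAdjoint_conj hx v) hx h1 hf
  rw [cfc_conj_unitary hv hx hf] at h2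
  rw [map_mul (f := π) (cfc f x), ← h2, ← map_mul, mul_assoc _ (star v),
    (Unitary.mem_iff.mp hv).1, mul_one]

lemma commute_star {v x : B} (hv : v ∈ unitary B)
    (h : π (v * x) = π (x * v)) : π (star v * x) = π (x * star v) := by
  have h1 : star v * (v * x) * star v = x * star v := by
    rw [← mul_assoc, (Unitary.mem_iff.mp hv).1, one_mul]
  have h2 : star v * (x * v) * star v = star v * x := by
    rw [mul_assoc, mul_assoc, (Unitary.mem_iff.mp hv).2, mul_one]
  rw [← h1, ← h2]
  simp only [map_mul] at h ⊢
  rw [h]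

variable [PartialOrder B] [StarOrderedRing B]

/-- Two commuting levels `p` and `G`, with `G` a unit for `p`, are separated by functional
calculus of the sum. -/
lemma cfc_posPart_add (hπ : CStarKernel π) {G p : B} (hp : 0 ≤ p) (hG : IsSelfAdjoint G)
    (hG1 : G ≤ 1) (h : π (G * p) = π p) :
    π (cfc (fun x : ℝ => max (x - 1) 0) (G + p)) = π p := by
  have hpsa : IsSelfAdjoint p := .of_nonneg hp
  have h' : π (p * G) = π p := by
    simpa [hG.star_eq, hpsa.star_eq] using hπ.star_eq h
  -- Modulo the kernel `p` is orthogonal to `1 - G`, so `T = p - (1 - G)` and `D = p + (1 - G)` have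
  -- the same square. As `D` is positive, it is `|T|`, and the positive part `(|T| + T) / 2` of `T`
  -- is `p`.
  set T := G + p - 1 with hT
  have hTsa : IsSelfAdjoint T := (hG.add hpsa).sub (.one B)
  set D := p + (1 - G) with hD
  have hD0 : 0 ≤ D := add_nonneg hp (sub_nonneg.mpr hG1)
  have hDsa : IsSelfAdjoint D := .of_nonneg hD0
  have hsq : π (T * T) = π (D * D) := by
    have e : D * D - T * T = 2 * (p - G * p) + 2 * (p - p * G) := by
      rw [hT, hD]; noncomm_ring
    rw [eq_comm, ← sub_eq_zero, ← map_sub, e]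
    simp [h, h']
  have habs : ∀ y : B, IsSelfAdjoint y → cfc (fun x : ℝ => Real.sqrt x) (y * y) =
      cfc (fun x : ℝ => |x|) y := by
    intro y hy
    have : y * y = cfc (fun x : ℝ => x * x) y := by
      rw [cfc_mul (fun x : ℝ => x) (fun x => x) y, cfc_id' ℝ y]
    rw [this, cfc_comp_of_continuous hy Real.continuous_sqrt (by fun_prop)]
    exact cfc_congr fun x _ => Real.sqrt_mul_self_eq_abs x
  have h1 : π (cfc (fun x : ℝ => |x|) T) = π D := by
    rw [← habs T hTsa, hπ.cfc_eq (hTsa.mul_self_nonneg.isSelfAdjoint)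
      (hDsa.mul_self_nonneg.isSelfAdjoint) hsq Real.continuous_sqrt, habs D hDsa]
    congr 1
    conv_rhs => rw [← cfc_id' ℝ D]
    exact cfc_congr fun x hx => abs_of_nonneg (spectrum_nonneg_of_nonneg hD0 hx)
  have e1 : cfc (fun x : ℝ => max (x - 1) 0) (G + p) = (1 / 2 : ℝ) • (cfc (fun x : ℝ => |x|) T + T) := by
    have hS : IsSelfAdjoint (G + p) := hG.add hpsa
    have e2 : T = cfc (fun x : ℝ => x - 1) (G + p) := by
      rw [cfc_sub (fun x : ℝ => x) (fun _ => (1 : ℝ)) (G + p), cfc_id' ℝ (G + p),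
        cfc_const_one ℝ (G + p)]
    rw [e2, cfc_comp_of_continuous hS (by fun_prop) (by fun_prop), ← cfc_add (G + p) _ _,
      ← cfc_smul _ _ (G + p)]
    refine cfc_congr fun x _ => ?_
    simp only [smul_eq_mul]
    rcases le_total 0 (x - 1) with hx | hx
    · rw [max_eq_left hx, abs_of_nonneg hx]; ring
    · rw [max_eq_right hx, abs_of_nonpos hx]; ring
  have e3 : p = (1 / 2 : ℝ) • (D + T) := by
    have : D + T = (2 : ℝ) • p := by rw [hD, hT, two_smul]; abel
    rw [this, smul_smul]; norm_num
  have e4 : ∀ c : ℝ, ∀ x : B, c • x = algebraMap ℝ B c * x := fun c x => Algebra.smul_def c x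
  conv_rhs => rw [e3]
  rw [e1, e4, e4, map_mul, map_mul, map_add, map_add, h1]

end CStarKernel

/-! ### Piecewise linear cut-off functions. -/

section Ramp

/-- The piecewise linear function which is zero below `s` and one above `t`. -/
noncomputable def ramp (s t z : ℝ) : ℝ := min 1 (max (z - s) 0 / (t - s))

lemma continuous_ramp (s t : ℝ) : Continuous (ramp s t) := by
  unfold ramp; fun_prop

variable {s t : ℝ}

lemma ramp_nonneg (h : s < t) (z : ℝ) : 0 ≤ ramp s t z := by
  have : 0 < t - s := sub_pos.mpr h
  unfold ramp; positivity

lemma continuous_inv_max {f : ℝ → ℝ} (hf : Continuous f) (h : s < t) :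
    Continuous fun z : ℝ => 1 / max (t - s) (f z) :=
  continuous_const.div (by fun_prop) fun _ =>
    (lt_of_lt_of_le (sub_pos.mpr h) (le_max_left _ _)).ne'

/-- The factor `max (t - s) (z - s)` is bounded below by `t - s`, hence invertible. So `ramp s t`
and `(z - s)₊`, and likewise `1 - ramp s t` and `(t - z)₊`, annihilate the same elements; level
relations may be used in either form. -/
lemma max_sub_eq_ramp_mul (h : s < t) (z : ℝ) :
    max (z - s) 0 = ramp s t z * max (t - s) (z - s) := by
  have h0 : 0 < t - s := sub_pos.mpr h
  unfold ramp
  rcases le_total z s with h1 | h1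
  · rw [max_eq_right (by linarith : z - s ≤ 0)]; simp
  · rw [max_eq_left (by linarith : 0 ≤ z - s)]
    rcases le_total z t with h' | h'
    · rw [max_eq_left (by linarith : z - s ≤ t - s), min_eq_right]
      · field_simp
      · rw [div_le_one h0]; linarith
    · rw [max_eq_right (by linarith : t - s ≤ z - s), min_eq_left, one_mul]
      rw [one_le_div h0]; linarith

lemma max_sub_eq_mul_one_sub_ramp (h : s < t) (z : ℝ) :
    max (t - z) 0 = max (t - s) (t - z) * (1 - ramp s t z) := by
  have h0 : 0 < t - s := sub_pos.mpr h
  unfold ramp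
  rcases le_total z s with h1 | h1
  · rw [max_eq_right (by linarith : z - s ≤ 0), max_eq_right (by linarith : t - s ≤ t - z),
      max_eq_left (by linarith : 0 ≤ t - z)]
    simp
  · rw [max_eq_left (by linarith : 0 ≤ z - s), max_eq_left (by linarith : t - z ≤ t - s)]
    rcases le_total z t with h' | h'
    · rw [max_eq_left (by linarith : 0 ≤ t - z), min_eq_right]
      · field_simp; ring
      · rw [div_le_one h0]; linarith
    · rw [max_eq_right (by linarith : t - z ≤ 0), min_eq_left]
      · simp
      · rw [one_le_div h0]; linarith

lemma ramp_eq_max_sub_mul (h : s < t) (z : ℝ) :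
    ramp s t z = max (z - s) 0 * (1 / max (t - s) (z - s)) := by
  have : max (t - s) (z - s) ≠ 0 := (lt_of_lt_of_le (sub_pos.mpr h) (le_max_left _ _)).ne'
  rw [max_sub_eq_ramp_mul h z]
  field_simp

lemma one_sub_ramp_eq (h : s < t) (z : ℝ) :
    1 - ramp s t z = 1 / max (t - s) (t - z) * max (t - z) 0 := by
  have : max (t - s) (t - z) ≠ 0 := (lt_of_lt_of_le (sub_pos.mpr h) (le_max_left _ _)).ne'
  rw [max_sub_eq_mul_one_sub_ramp h z]
  field_simp

variable {B : Type*} [CStarAlgebra B]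

lemma one_sub_cfc_ramp {a : B} (ha : IsSelfAdjoint a) (h : s < t) :
    1 - cfc (ramp s t) a = cfc (fun z : ℝ => 1 / max (t - s) (t - z)) a *
      cfc (fun z : ℝ => max (t - z) 0) a := by
  rw [one_sub_cfc ha (continuous_ramp s t)]
  exact cfc_eq_mul (continuous_inv_max (by fun_prop) h) (by fun_prop) fun z _ =>
    one_sub_ramp_eq h z

lemma cfc_max_sub_eq_mul_one_sub_ramp {a : B} (ha : IsSelfAdjoint a) (h : s < t) :
    cfc (fun z : ℝ => max (t - z) 0) a = cfc (fun z : ℝ => max (t - s) (t - z)) a *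
      (1 - cfc (ramp s t) a) := by
  have := continuous_ramp s t
  rw [one_sub_cfc ha this]
  exact cfc_eq_mul (by fun_prop) (by fun_prop) fun z _ => max_sub_eq_mul_one_sub_ramp h z

lemma cfc_max_sub_eq_ramp_mul (a : B) (h : s < t) :
    cfc (fun z : ℝ => max (z - s) 0) a = cfc (ramp s t) a *
      cfc (fun z : ℝ => max (t - s) (z - s)) a :=
  cfc_eq_mul (continuous_ramp s t) (by fun_prop) fun z _ => max_sub_eq_ramp_mul h z

lemma cfc_ramp_eq_max_sub_mul (a : B) (h : s < t) :
    cfc (ramp s t) a = cfc (fun z : ℝ => max (z - s) 0) a *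
      cfc (fun z : ℝ => 1 / max (t - s) (z - s)) a :=
  cfc_eq_mul (by fun_prop) (continuous_inv_max (by fun_prop) h) fun z _ =>
    ramp_eq_max_sub_mul h z

end Ramp

/-! ### Moving one spectral level while fixing the levels above it. -/

section Step

variable {B Q : Type*} [CStarAlgebra B] [Ring Q]

/-- Modulo the kernel of `π`, the spectral projection of `x` for `(s, ∞)` lies below the spectral
projection of `y` for `[t, ∞)`. -/
def LevelLE (π : B →+* Q) (x : B) (s : ℝ) (y : B) (t : ℝ) : Prop :=
  π (cfc (fun z : ℝ => max (t - z) 0) y * cfc (fun z : ℝ => max (z - s) 0) x) = 0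

variable {π : B →+* Q}

/-- The function `(t' - z)₊` is a continuous multiple of `(t - z)₊`: where the former is nonzero,
the latter is at least `t - t'`. -/
lemma LevelLE.mono {x y : B} {s t t' : ℝ} (h : LevelLE π x s y t) (ht : t' < t) :
    LevelLE π x s y t' := by
  have e : cfc (fun z : ℝ => max (t' - z) 0) y =
      cfc (fun z : ℝ => max (t' - z) 0 / max (t - z) (t - t')) y *
        cfc (fun z : ℝ => max (t - z) 0) y := by
    have hpos : ∀ z : ℝ, max (t - z) (t - t') ≠ 0 := fun z =>
      (lt_of_lt_of_le (sub_pos.mpr ht) (le_max_right _ _)).ne'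
    refine cfc_eq_mul (by fun_prop (disch := exact hpos _)) (by fun_prop) fun z _ => ?_
    rcases le_total t' z with hz | hz
    · rw [max_eq_right (by linarith : t' - z ≤ 0)]; simp
    · rw [max_eq_left (by linarith : t - t' ≤ t - z), max_eq_left (by linarith : 0 ≤ t - z),
        div_mul_cancel₀]
      exact (by linarith : 0 < t - z).ne'
  unfold LevelLE at h ⊢
  rw [e, mul_assoc, map_mul, h, mul_zero]

/-- Elements which agree with their products with `h` can be flipped by unitaries that commute
with `h`, everything modulo the kernel of `π`. -/
def HasFlips [PartialOrder B] (π : B →+* Q) (e : B) : Prop :=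
  ∀ h x : B, 0 ≤ h → h ≤ 1 → (h = e ∨ π (e * h) = π h) → π (h * x) = π x → π (x * h) = π x →
    ∃ u ∈ unitary B, π (u * (star x * x) * star u) = π (x * star x) ∧ π (u * h) = π (h * u)

/-- A unit for `c²` is a unit for `c`, because `(1 - f) c² (1 - f)⋆` vanishes modulo the kernel.
This transfers unit relations to square roots. -/
lemma CStarKernel.mul_eq_of_mul_self (hπ : CStarKernel π) {f c : B} (hc : IsSelfAdjoint c)
    (h : π (f * (c * c)) = π (c * c)) : π f * π c = π c := by
  have : π ((1 - f) * c) = 0 := by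
    refine hπ.mul_eq_zero_of_sq ?_
    rw [hc.star_eq, map_mul, sub_mul, one_mul, map_sub, h, sub_self, zero_mul]
  rw [sub_mul, one_mul, map_sub, map_mul, sub_eq_zero] at this
  exact this.symm

variable [PartialOrder B] [StarOrderedRing B]

lemma cfc_ramp_nonneg (a : B) {s t : ℝ} (h : s < t) : 0 ≤ cfc (ramp s t) a :=
  cfc_nonneg fun _ _ => ramp_nonneg h _

lemma cfc_ramp_le_one (a : B) (s t : ℝ) : cfc (ramp s t) a ≤ 1 :=
  cfc_le_one _ _ fun _ _ => min_le_left _ _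

lemma cfc_max_sub_nonneg (a : B) (s : ℝ) : 0 ≤ cfc (fun z : ℝ => max (z - s) 0) a :=
  cfc_nonneg fun _ _ => le_max_right _ _

lemma exists_isSelfAdjoint_mul_self {x : B} (hx : 0 ≤ x) :
    ∃ c : B, IsSelfAdjoint c ∧ c * c = x := by
  refine ⟨cfc (fun z : ℝ => √z) x, isSelfAdjoint_cfc _, ?_⟩
  rw [← cfc_mul _ _ x (by fun_prop) (by fun_prop)]
  conv_rhs => rw [← cfc_id' ℝ x]
  exact cfc_congr fun z hz => Real.mul_self_sqrt (spectrum_nonneg_of_nonneg hx hz)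

/-- The condition `hfs` makes `f` linear on `[0, s]`, so `f z / z` extends continuously through zero
and `f(a)` is a multiple of `a`. -/
lemma map_mul_cfc_eq {a e : B} (ha : 0 ≤ a) (hea : π (e * a) = π a) {f : ℝ → ℝ}
    (hf : Continuous f) {s : ℝ} (hs : 0 < s) (hfs : ∀ z, 0 ≤ z → z ≤ s → f z * s = z * f s) :
    π (e * cfc f a) = π (cfc f a) := by
  have hpos : ∀ z : ℝ, max z s ≠ 0 := fun z => (lt_of_lt_of_le hs (le_max_right _ _)).ne'
  have : cfc f a = a * cfc (fun z : ℝ => f (max z s) / max z s) a := by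
    nth_rewrite 2 [← cfc_id' ℝ a]
    refine cfc_eq_mul continuous_id ?_ fun z hz => ?_
    · exact Continuous.div (by fun_prop) (by fun_prop) hpos
    · have hz0 := spectrum_nonneg_of_nonneg ha hz
      rcases le_total z s with h | h
      · rw [max_eq_right h, mul_div_assoc', eq_div_iff hs.ne']
        exact hfs z hz0 h
      · rw [max_eq_left h, mul_div_cancel₀ _ (by linarith : 0 < z).ne']
  rw [this, ← mul_assoc, map_mul, hea, map_mul]

/-- A positive contraction, a function of `a`, which is a unit for the part of `a` above `s`. -/
lemma exists_level_unit {a : B} (ha : 0 ≤ a) {s : ℝ} (hs : 0 < s) :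
    ∃ k : B, 0 ≤ k ∧ k ≤ 1 ∧ cfc (fun z : ℝ => max (s - z) 0) a = s • (1 - k) ∧
      (∀ e : B, π (e * a) = π a → π (e * k) = π k) := by
  have hasa : IsSelfAdjoint a := .of_nonneg ha
  -- On the spectrum of `a` this function is `min (z / s) 1`.
  refine ⟨cfc (fun z : ℝ => 1 - s⁻¹ * max (s - z) 0) a, cfc_nonneg fun z hz => ?_,
    cfc_le_one _ _ fun z _ => ?_, ?_, fun e he => ?_⟩
  · have := spectrum_nonneg_of_nonneg ha hz
    have h1 : max (s - z) 0 ≤ s := max_le (by linarith) hs.le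
    have h2 := mul_le_mul_of_nonneg_left h1 (inv_pos.mpr hs).le
    rw [inv_mul_cancel₀ hs.ne'] at h2
    linarith
  · have : 0 ≤ s⁻¹ * max (s - z) 0 := by positivity
    linarith
  · rw [one_sub_cfc hasa (by fun_prop), ← cfc_smul _ _ a]
    refine cfc_congr fun z _ => ?_
    simp only [smul_eq_mul, sub_sub_cancel]
    rw [mul_inv_cancel_left₀ hs.ne']
  · refine map_mul_cfc_eq ha he (by fun_prop) hs fun z hz0 hz => ?_
    rw [max_eq_left (by linarith : 0 ≤ s - z), sub_self, max_self]
    field_simp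
    ring

/-- A substitute for the polar decomposition: `y₁ = y · max(y⋆y, δ)^(-1/2)`. It is a right multiple
of `y`, hence has the same left units, and `y₁⋆y₁` acts as the identity on the part of `y⋆y` above
`δ`. -/
lemma exists_isometric_part {y : B} {δ : ℝ} (hδ : 0 < δ) :
    ∃ y₁ : B, (∀ k : B, π (k * y) = π y → π (k * y₁) = π y₁) ∧ star y₁ * y₁ ≤ 1 ∧
      star y₁ * y₁ = cfc (fun z : ℝ => z / max z δ) (star y * y) := by
  have hpos : ∀ z : ℝ, max z δ ≠ 0 := fun z => (lt_of_lt_of_le hδ (le_max_right _ _)).ne'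
  have hpos' : ∀ z : ℝ, √(max z δ) ≠ 0 := fun z =>
    (Real.sqrt_pos.mpr (lt_of_lt_of_le hδ (le_max_right _ _))).ne'
  have hc : Continuous fun z : ℝ => 1 / √(max z δ) :=
    continuous_const.div (by fun_prop) hpos'
  have key : star (y * cfc (fun z : ℝ => 1 / √(max z δ)) (star y * y)) *
      (y * cfc (fun z : ℝ => 1 / √(max z δ)) (star y * y)) =
        cfc (fun z : ℝ => z / max z δ) (star y * y) := by
    rw [star_mul, (isSelfAdjoint_cfc _).star_eq, mul_assoc, ← mul_assoc (star y)]
    nth_rewrite 2 [← cfc_id' ℝ (star y * y)]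
    have hc' : Continuous fun z : ℝ => z * (1 / √(max z δ)) := continuous_id.mul hc
    rw [← cfc_mul _ _ (star y * y) (by fun_prop) hc.continuousOn,
      ← cfc_mul _ _ (star y * y) hc.continuousOn hc'.continuousOn]
    refine cfc_congr fun z _ => ?_
    have h1 := Real.mul_self_sqrt (lt_of_lt_of_le hδ (le_max_right z δ)).le
    rw [mul_left_comm, div_mul_div_comm, h1]
    ring
  refine ⟨_, fun k hk => ?_, ?_, key⟩
  · rw [← mul_assoc, map_mul, hk, map_mul]
  · rw [key]
    refine cfc_le_one _ _ fun z _ => ?_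
    rw [div_le_one (lt_of_lt_of_le hδ (le_max_right _ _))]
    exact le_max_left _ _

lemma exists_level_ramp {b : B} (hb : 0 ≤ b) {t : ℝ} (t₁ : ℝ) (ht : 0 < t) :
    (∀ e : B, π (e * b) = π b → π (e * cfc (ramp t t₁) b) = π (cfc (ramp t t₁) b)) ∧
      ∀ f : ℝ → ℝ, Continuous f → (∀ z, t ≤ z → f z = 1) →
        cfc f b * cfc (ramp t t₁) b = cfc (ramp t t₁) b ∧
          cfc (ramp t t₁) b * cfc f b = cfc (ramp t t₁) b := by
  have hr := continuous_ramp t t₁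
  have key : ∀ z ≤ t, ramp t t₁ z = 0 := fun z h => by
    rw [ramp, max_eq_right (by linarith : z - t ≤ 0)]; simp
  refine ⟨fun e he => ?_, fun f hf hf1 => ⟨?_, ?_⟩⟩
  · exact map_mul_cfc_eq hb he hr ht fun z _ hz => by rw [key z hz, key t le_rfl]; simp
  · refine (cfc_eq_mul hf hr fun z _ => ?_).symm
    rcases le_total z t with h | h
    · rw [key z h, mul_zero]
    · rw [hf1 z h, one_mul]
  · refine (cfc_eq_mul hr hf fun z _ => ?_).symm
    rcases le_total z t with h | h
    · rw [key z h, zero_mul]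
    · rw [hf1 z h, mul_one]

/-- The unitary which moves a two-level element `G + p`, knowing that `G` can be compressed by
`y₁` into the hereditary subalgebra with unit `k`, without moving the upper level `p`. -/
lemma exists_unitary_of_two_levels (hπ : CStarKernel π) {e k G F p y₁ : B}
    (he : 0 ≤ e) (he1 : e ≤ 1) (hflip : HasFlips π e) (hk0 : 0 ≤ k) (hk1 : k ≤ 1)
    (hek : π (e * k) = π k) (KY : π k * π y₁ = π y₁) (hy₁ : star y₁ * y₁ ≤ 1)
    (YY : π (star y₁) * π y₁ = π F) (hG0 : 0 ≤ G) (hG1 : G ≤ 1) (hp0 : 0 ≤ p)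
    (heG : π (e * G) = π G) (hep : π (e * p) = π p)
    (hFG : F * G = G) (hGF : G * F = G) (hGp : π G * π p = π p) (hkp : π (k * p) = π p) :
    ∃ v ∈ unitary B, ∃ G' : B, π (v * e) = π (e * v) ∧ π (v * p) = π (p * v) ∧
      π (v * G * star v) = π G' ∧ π (k * G') = π G' := by
  have hesa : IsSelfAdjoint e := .of_nonneg he
  have hksa : IsSelfAdjoint k := .of_nonneg hk0
  have hGsa : IsSelfAdjoint G := .of_nonneg hG0
  have hpsa : IsSelfAdjoint p := .of_nonneg hp0
  have hFp : π F * π p = π p := by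
    rw [← hGp, ← mul_assoc, ← map_mul, hFG]
  obtain ⟨ρ, hρsa, hρρ⟩ := exists_isSelfAdjoint_mul_self hp0
  have hFρ : π F * π ρ = π ρ := hπ.mul_eq_of_mul_self hρsa (by rw [hρρ, map_mul, hFp])
  have hkρ : π k * π ρ = π ρ := hπ.mul_eq_of_mul_self hρsa (by rw [hρρ, hkp])
  have hρk : π ρ * π k = π ρ := by
    have := hπ.star_eq (x := k * ρ) (y := ρ) (by rw [map_mul, hkρ])
    simpa [hρsa.star_eq, hksa.star_eq] using this
  have hPρ : π p = π ρ * π ρ := by rw [← hρρ, map_mul]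
  -- bringing the image of `p` under `y₁` back to `p`
  obtain ⟨u, hu, hu1, hu2⟩ := hflip k (y₁ * ρ) hk0 hk1 (Or.inr hek)
    (by rw [← mul_assoc, map_mul, map_mul, KY, ← map_mul])
    (by rw [map_mul, map_mul, mul_assoc, hρk])
  have WK : π (star u) * π k = π k * π (star u) := by
    simpa using CStarKernel.commute_star hu hu2
  have hWsW : π u * π (star u) = 1 := by rw [← map_mul, (Unitary.mem_iff.mp hu).2, map_one]
  have hWWs : π (star u) * π u = 1 := by rw [← map_mul, (Unitary.mem_iff.mp hu).1, map_one]
  -- For `x = y₁ρ` one has `x⋆x = ρFρ = p` and `xx⋆ = y₁ p y₁⋆`, so `u` carries `p` to `y₁ p y₁⋆`.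
  -- Thus `star u * y₁` maps `p` to itself, and it still has `k` as a left unit because `u` commutes
  -- with `k`.
  have hP : π (star u) * π y₁ * π p * π (star y₁) * π u = π p := by
    have h1 : π (star u) * π (u * (star (y₁ * ρ) * (y₁ * ρ)) * star u) * π u =
        π (star u) * π ((y₁ * ρ) * star (y₁ * ρ)) * π u := by rw [hu1]
    simp only [star_mul, hρsa.star_eq, map_mul, ← mul_assoc] at h1
    rw [hWWs, one_mul] at h1
    simp only [mul_assoc] at h1 ⊢
    rw [hWWs, mul_one, ← mul_assoc (π (star y₁)), YY, hFρ, ← hPρ] at h1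
    nth_rewrite 2 [h1]
    rw [hPρ]
    simp only [mul_assoc]
  -- moving the two levels at once
  obtain ⟨C, hCsa, hCC⟩ := exists_isSelfAdjoint_mul_self (add_nonneg hG0 hp0)
  have hFC : π F * π C = π C := hπ.mul_eq_of_mul_self hCsa (by
    rw [hCC, mul_add, map_add, map_add, hFG, map_mul, hFp])
  have hEC : π e * π C = π C := hπ.mul_eq_of_mul_self hCsa (by
    rw [hCC, mul_add, map_add, map_add, heG, hep])
  have hCE : π C * π e = π C := by
    have := hπ.star_eq (x := e * C) (y := C) (by rw [map_mul, hEC])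
    simpa [hesa.star_eq, hCsa.star_eq] using this
  have KWY : π k * (π (star u) * π y₁) = π (star u) * π y₁ := by
    rw [← mul_assoc, ← WK, mul_assoc, KY]
  -- For this `x`, `x⋆x = CFC = G + p` and `xx⋆ = G' + p` with `G' = u⋆ y₁ G y₁⋆ u`. The unit passes
  -- from `k` to `e` through `ek = k`.
  obtain ⟨v, hv, hv1, hv2⟩ := hflip e (star u * y₁ * C) he he1 (Or.inl rfl)
    (by
      have h1 : π (star u * y₁ * C) = π k * (π (star u) * π y₁) * π C := by
        rw [KWY, map_mul, map_mul]
      rw [map_mul, h1, ← mul_assoc, ← mul_assoc, ← map_mul, hek])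
    (by rw [map_mul, map_mul, mul_assoc, hCE])
  have hG'eq : π (star u * y₁ * G * star y₁ * u) =
    π (star u) * π y₁ * π G * π (star y₁) * π u := by simp only [map_mul]
  have hvGp : π (v * (G + p) * star v) = π (star u * y₁ * G * star y₁ * u + p) := by
    have h1 : π (star (star u * y₁ * C) * (star u * y₁ * C)) = π (G + p) := by
      rw [← hCC]
      simp only [star_mul, star_star, hCsa.star_eq, map_mul, mul_assoc]
      rw [← mul_assoc (π u), hWsW, one_mul, ← mul_assoc (π (star y₁)), YY, hFC]
    have h2 : π (star u * y₁ * C * star (star u * y₁ * C)) =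
        π (star u * y₁ * G * star y₁ * u + p) := by
      rw [map_add, hG'eq]
      nth_rewrite 1 [← hP]
      rw [← add_mul, ← add_mul, ← mul_add, ← map_add, ← hCC]
      simp only [star_mul, star_star, hCsa.star_eq, map_mul, mul_assoc]
    rw [map_mul, map_mul, h1, h2, ← map_mul, ← map_mul] at hv1
    exact hv1
  have hG'sa : IsSelfAdjoint (star u * y₁ * G * star y₁ * u) := by
    have := isSelfAdjoint_conj hGsa (star u * y₁)
    simpa only [star_mul, star_star, ← mul_assoc] using this
  have hG'1 : star u * y₁ * G * star y₁ * u ≤ 1 := by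
    have h1 : y₁ * G * star y₁ ≤ y₁ * star y₁ := by
      simpa using star_right_conjugate_le_conjugate hG1 y₁
    have h2 : y₁ * star y₁ ≤ 1 := by
      have h3 : ‖y₁ * star y₁‖ ≤ 1 := by
        rw [CStarRing.norm_self_mul_star, ← CStarRing.norm_star_mul_self]
        exact (CStarAlgebra.norm_le_one_iff_of_nonneg _ (star_mul_self_nonneg y₁)).mpr hy₁
      exact (CStarAlgebra.norm_le_one_iff_of_nonneg _ (mul_star_self_nonneg y₁)).mp h3
    have h3 := star_left_conjugate_le_conjugate (h1.trans h2) u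
    rw [mul_one, (Unitary.mem_iff.mp hu).1] at h3
    refine le_trans (le_of_eq ?_) h3
    simp only [mul_assoc]
  have hG'p : π (star u * y₁ * G * star y₁ * u * p) = π p := by
    rw [map_mul, hG'eq]
    nth_rewrite 1 [← hP]
    simp only [mul_assoc]
    rw [← mul_assoc (π u), hWsW, one_mul, ← mul_assoc (π (star y₁)), YY, ← mul_assoc (π G),
      ← map_mul π G, hGF, ← mul_assoc (π G), hGp]
    simpa only [mul_assoc] using hP
  have hGpsa : IsSelfAdjoint (G + p) := hGsa.add hpsa
  -- In both `G + p` and `G' + p` the first summand is a unit for `p` and at most 1, so the function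
  -- `(z - 1)₊` extracts the same `p` from each; hence `v` fixes `p`.
  have hvp : π (v * p * star v) = π p := by
    have h1 := hπ.cfc_eq (f := fun x : ℝ => max (x - 1) 0) (isSelfAdjoint_conj hGpsa v)
      (hG'sa.add hpsa) hvGp (by fun_prop)
    rw [hπ.cfc_posPart_add hp0 hG'sa hG'1 hG'p, cfc_conj_unitary hv hGpsa (by fun_prop), map_mul,
      map_mul, hπ.cfc_posPart_add hp0 hGsa hG1 (by rw [map_mul, hGp]), ← map_mul, ← map_mul] at h1
    exact h1
  refine ⟨v, hv, star u * y₁ * G * star y₁ * u, hv2, ?_, ?_, ?_⟩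
  · rw [map_mul π p, ← hvp, ← map_mul, mul_assoc _ (star v), (Unitary.mem_iff.mp hv).1, mul_one]
  · rw [mul_add, add_mul, map_add, map_add, hvp] at hvGp
    exact add_right_cancel hvGp
  · rw [map_mul, hG'eq]
    simp only [← mul_assoc]
    rw [mul_assoc (π k), KWY]

theorem exists_unitary_levelLE (hπ : CStarKernel π) {a b e y : B} {s₀ s₁ t₀ t t₁ : ℝ}
    (ha : 0 ≤ a) (hb : 0 ≤ b) (he : 0 ≤ e) (he1 : e ≤ 1) (hflip : HasFlips π e)
    (hea : π (e * a) = π a) (heb : π (e * b) = π b)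
    (hs₀ : 0 < s₀) (hs : s₀ ≤ s₁) (ht₀ : 0 ≤ t₀) (ht : t₀ < t) (ht₁ : t < t₁)
    (hab : LevelLE π a s₁ b t₁)
    (hy : π (star y * y) = π (cfc (fun z : ℝ => max (z - t₀) 0) b))
    (hya : π (cfc (fun z : ℝ => max (s₀ - z) 0) a * y) = 0) :
    ∃ v ∈ unitary B, π (v * e) = π (e * v) ∧
      π (v * cfc (fun z : ℝ => max (z - s₁) 0) a) = π (cfc (fun z : ℝ => max (z - s₁) 0) a * v) ∧
      LevelLE π (v * b * star v) t a s₀ := by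
  have hbsa : IsSelfAdjoint b := .of_nonneg hb
  have hδ : 0 < t - t₀ := by linarith
  have hinv : algebraMap ℝ B s₀⁻¹ * algebraMap ℝ B s₀ = 1 := by
    rw [← map_mul, inv_mul_cancel₀ hs₀.ne', map_one]
  obtain ⟨k, hk0, hk1, hk, hek⟩ := exists_level_unit (π := π) ha hs₀
  have unit_k : ∀ x : B, π (cfc (fun z : ℝ => max (s₀ - z) 0) a * x) = 0 → π (k * x) = π x := by
    intro x hx
    have : (1 - k) * x = algebraMap ℝ B s₀⁻¹ * (cfc (fun z : ℝ => max (s₀ - z) 0) a * x) := by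
      rw [hk, Algebra.smul_def, ← mul_assoc, ← mul_assoc, hinv, one_mul]
    have h2 : π ((1 - k) * x) = 0 := by rw [this, map_mul, hx, mul_zero]
    rw [sub_mul, one_mul, map_sub, sub_eq_zero] at h2
    exact h2.symm
  obtain ⟨y₁, hy₁, hy₁le, hy₁y₁⟩ := exists_isometric_part (π := π) (y := y) hδ
  obtain ⟨heG, hGf⟩ := exists_level_ramp (π := π) hb t₁ (by linarith : 0 < t)
  have hG0 := cfc_ramp_nonneg b ht₁
  have hG1 := cfc_ramp_le_one b t t₁
  have hGH := one_sub_cfc_ramp hbsa ht₁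
  have hGK := cfc_max_sub_eq_ramp_mul b ht₁
  set G := cfc (ramp t t₁) b
  set H := cfc (fun z : ℝ => 1 / max (t₁ - t) (t₁ - z)) b
  set K := cfc (fun z : ℝ => max (t₁ - t) (z - t)) b
  have hpos : ∀ z : ℝ, max z (t - t₀) ≠ 0 := fun z =>
    (lt_of_lt_of_le hδ (le_max_right _ _)).ne'
  have hFc : Continuous fun z : ℝ => max (z - t₀) 0 / max (max (z - t₀) 0) (t - t₀) :=
    Continuous.div (by fun_prop) (by fun_prop) fun z => hpos _
  obtain ⟨hFG, hGF⟩ := hGf _ hFc (fun z h => by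
    rw [max_eq_left (by linarith : 0 ≤ z - t₀), max_eq_left (by linarith : t - t₀ ≤ z - t₀),
      div_self (by linarith : 0 < z - t₀).ne'])
  have YY : π (star y₁) * π y₁ =
      π (cfc (fun z : ℝ => max (z - t₀) 0 / max (max (z - t₀) 0) (t - t₀)) b) := by
    have hc : Continuous fun z : ℝ => z / max z (t - t₀) :=
      continuous_id.div (by fun_prop) hpos
    rw [← map_mul, hy₁y₁, hπ.cfc_eq (.star_mul_self y) (isSelfAdjoint_cfc _) hy hc,
      cfc_comp_of_continuous hbsa hc (by fun_prop)]
  -- The level to be preserved is `p = (a - s₁)₊`. It lies under `G` by `hab` and under `k` because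
  -- `s₀ ≤ s₁`. The level `G` is supported where `b ≥ t`, and there `F = y₁⋆y₁` is 1.
  obtain ⟨v, hv, G', hve, hvp, hvG, hkG'⟩ := exists_unitary_of_two_levels hπ
    (p := cfc (fun z : ℝ => max (z - s₁) 0) a) he he1 hflip hk0 hk1 (hek e hea)
    (by rw [← map_mul, hy₁ k (unit_k y hya)]) hy₁le YY hG0 hG1 (cfc_max_sub_nonneg a s₁)
    (heG e heb)
    (map_mul_cfc_eq ha hea (by fun_prop) (by linarith : 0 < s₁) fun z _ hz => by
      rw [max_eq_right (by linarith : z - s₁ ≤ 0)]; simp)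
    hFG hGF
    (by
      have h2 : π ((1 - G) * cfc (fun z : ℝ => max (z - s₁) 0) a) = 0 := by
        unfold LevelLE at hab
        rw [hGH, mul_assoc, map_mul, hab, mul_zero]
      rw [sub_mul, one_mul, map_sub, map_mul, sub_eq_zero] at h2
      exact h2.symm)
    (unit_k _ (by
      rw [cfc_mul_eq_zero (by fun_prop) (by fun_prop), map_zero]
      intro z _
      rcases le_total z s₁ with h | h
      · rw [max_eq_right (by linarith : z - s₁ ≤ 0)]; simp
      · rw [max_eq_right (by linarith : s₀ - z ≤ 0)]; simp))
  refine ⟨v, hv, hve, hvp, ?_⟩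
  -- Since `(b - t)₊` is a multiple of `G` and `(s₀ - a)₊` is `s₀ (1 - k)`, this vanishing is the
  -- required level relation.
  have h3 : π ((1 - k) * (v * G * star v)) = 0 := by
    rw [map_mul, hvG, ← map_mul, sub_mul, one_mul, map_sub, hkG', sub_self]
  unfold LevelLE
  have h4 : s₀ • (1 - k) * (v * (G * K) * star v) =
      algebraMap ℝ B s₀ * ((1 - k) * (v * G * star v)) * (v * K * star v) := by
    have : v * (G * K) * star v = v * G * star v * (v * K * star v) := by
      rw [show v * G * star v * (v * K * star v) = v * G * (star v * v) * K * star v by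
        simp only [mul_assoc], (Unitary.mem_iff.mp hv).1, mul_one]
      simp only [mul_assoc]
    rw [this, Algebra.smul_def]
    simp only [mul_assoc]
  rw [cfc_conj_unitary hv hbsa (by fun_prop), hk, hGK, h4, map_mul, map_mul, h3, mul_zero, zero_mul]

end Step

/-! ### Descending through all levels. -/

section Chain

variable {B Q : Type*} [CStarAlgebra B] [Ring Q] {π : B →+* Q}

lemma commute_conj_of_commute {v c x : B} (hv : v ∈ unitary B) (h : π (v * c) = π (c * v)) :
    π (v * x * star v * c) = π (v * (x * c) * star v) := by
  have h1 := CStarKernel.commute_star hv h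
  simp only [map_mul, mul_assoc] at h1 ⊢
  rw [h1]

lemma cfc_max_sub_cfc_max_sub {a : B} (ha : IsSelfAdjoint a) {s₁ s : ℝ} (hs : s₁ ≤ s) :
    cfc (fun z : ℝ => max (z - s) 0) a =
      cfc (fun z : ℝ => max (z - (s - s₁)) 0) (cfc (fun z : ℝ => max (z - s₁) 0) a) := by
  rw [cfc_comp_of_continuous ha (by fun_prop) (by fun_prop)]
  refine cfc_congr fun z _ => ?_
  rcases le_total z s₁ with h | h
  · simp only [max_eq_right (by linarith : z - s₁ ≤ 0)]
    rw [max_eq_right (by linarith), max_eq_right (by linarith)]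
  · simp only [max_eq_left (by linarith : 0 ≤ z - s₁)]
    congr 1; ring

/-- For `s ≥ s₁` the cut-down `(a - s)₊` is a function of `(a - s₁)₊`, so `v` commutes with it and
the relation survives conjugation of `b`. -/
lemma LevelLE.conj_right (hπ : CStarKernel π) {a b v : B} {s₁ s t : ℝ} (ha : IsSelfAdjoint a)
    (hb : IsSelfAdjoint b) (hv : v ∈ unitary B)
    (hva : π (v * cfc (fun z : ℝ => max (z - s₁) 0) a) = π (cfc (fun z : ℝ => max (z - s₁) 0) a * v))
    (hs : s₁ ≤ s) (h : LevelLE π a s b t) : LevelLE π a s (v * b * star v) t := by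
  unfold LevelLE at h ⊢
  have h1 := hπ.commute_cfc hv (isSelfAdjoint_cfc _) hva
    (f := fun z : ℝ => max (z - (s - s₁)) 0) (by fun_prop)
  rw [← cfc_max_sub_cfc_max_sub ha hs] at h1
  rw [cfc_conj_unitary hv hb (by fun_prop), commute_conj_of_commute hv h1, map_mul, map_mul, h,
    mul_zero, zero_mul]

/-- Here `(t - a)₊` is not a function of `(a - s₁)₊`, but `ramp s₁ t` applied to `a` is, and `1 -
ramp s₁ t` has the same annihilated elements as `(t - a)₊`. The slope of the ramp requires the
strict inequality `s₁ < t`. -/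
lemma LevelLE.conj_left (hπ : CStarKernel π) {a b v : B} {s₁ s t : ℝ} (ha : IsSelfAdjoint a)
    (hb : IsSelfAdjoint b) (hv : v ∈ unitary B)
    (hva : π (v * cfc (fun z : ℝ => max (z - s₁) 0) a) = π (cfc (fun z : ℝ => max (z - s₁) 0) a * v))
    (ht : s₁ < t) (h : LevelLE π b s a t) : LevelLE π (v * b * star v) s a t := by
  unfold LevelLE at h ⊢
  have h1 := hπ.commute_cfc hv (isSelfAdjoint_cfc _) hva
    (f := fun z : ℝ => min 1 (z / (t - s₁))) (by fun_prop)
  rw [cfc_comp_of_continuous ha (by fun_prop) (by fun_prop)] at h1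
  change π (v * cfc (ramp s₁ t) a) = π (cfc (ramp s₁ t) a * v) at h1
  have h2 : π ((1 - cfc (ramp s₁ t) a) * v) = π (v * (1 - cfc (ramp s₁ t) a)) := by
    rw [sub_mul, mul_sub, one_mul, mul_one, map_sub, map_sub, h1]
  rw [cfc_conj_unitary hv hb (by fun_prop), cfc_max_sub_eq_mul_one_sub_ramp ha ht]
  set L := cfc (fun z : ℝ => max (t - s₁) (t - z)) a
  set d := cfc (fun z : ℝ => max (z - s) 0) b
  have h3 : L * (1 - cfc (ramp s₁ t) a) * (v * d * star v) =
    L * ((1 - cfc (ramp s₁ t) a) * v) * (d * star v) := by simp only [mul_assoc]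
  have h4 : π ((1 - cfc (ramp s₁ t) a) * d) = 0 := by
    rw [one_sub_cfc_ramp ha ht, mul_assoc, map_mul, h, mul_zero]
  rw [h3, map_mul, map_mul, h2, ← map_mul, ← map_mul,
    show L * (v * (1 - cfc (ramp s₁ t) a)) * (d * star v) =
      (L * v) * ((1 - cfc (ramp s₁ t) a) * d) * star v by simp only [mul_assoc],
    map_mul, map_mul, h4, mul_zero, zero_mul]

/-- The cut-downs of `b` are Cuntz smaller than the cut-downs of `a` by less than `r`, modulo the
kernel of `π`. -/
def CutDownLE (π : B →+* Q) (r : ℝ) (b a : B) : Prop :=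
  ∀ s t : ℝ, 0 < s → s + r < t → ∃ y : B,
    π (star y * y) = π (cfc (fun z : ℝ => max (z - t) 0) b) ∧
      π (cfc (fun z : ℝ => max (s - z) 0) a * y) = 0

lemma CutDownLE.conj {a b u v : B} {r : ℝ} (ha : IsSelfAdjoint a) (hb : IsSelfAdjoint b)
    (hu : u ∈ unitary B) (hv : v ∈ unitary B) (h : CutDownLE π r b a) :
    CutDownLE π r (u * b * star u) (v * a * star v) := by
  intro s t hs hst
  obtain ⟨y, h1, h2⟩ := h s t hs hst
  refine ⟨v * y * star u, ?_, ?_⟩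
  · rw [cfc_conj_unitary hu hb (by fun_prop), map_mul _ _ (star u), map_mul _ u, ← h1, ← map_mul,
      ← map_mul]
    congr 1
    rw [star_mul, star_mul, star_star, show u * (star y * star v) * (v * y * star u) =
      u * (star y * (star v * v) * y) * star u by simp only [mul_assoc],
      (Unitary.mem_iff.mp hv).1, mul_one]
  · rw [cfc_conj_unitary hv ha (by fun_prop)]
    set d := cfc (fun z : ℝ => max (s - z) 0) a
    rw [show v * d * star v * (v * y * star u) = v * (d * (star v * v) * y) * star u by
      simp only [mul_assoc], (Unitary.mem_iff.mp hv).1, mul_one, map_mul, map_mul, h2, mul_zero,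
      zero_mul]

/-- The levels of `x` and `z`, in steps of `g` from `j * g` on, are interlaced. -/
def Interlaced (π : B →+* Q) (g η : ℝ) (x z : B) (j : ℕ) : Prop :=
  ∀ k : ℕ, LevelLE π x ((j + 2 * k + 1) * g - η) z ((j + 2 * k) * g) ∧
    LevelLE π z ((j + 2 * k + 2) * g - η) x ((j + 2 * k + 1) * g)

lemma levelLE_of_norm_le {x y : B} {s t : ℝ} (hx : IsSelfAdjoint x) (h : ‖x‖ ≤ s) :
    LevelLE π x s y t := by
  have : cfc (fun z : ℝ => max (z - s) 0) x = 0 := by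
    rw [← cfc_const_zero ℝ x]
    refine cfc_congr fun z hz => max_eq_right ?_
    have := (abs_le.mp (abs_le_norm_of_mem_spectrum hx hz)).2
    linarith
  rw [LevelLE, this, mul_zero, map_zero]

lemma conj_mem_unit {e b u : B} (hu : π (u * e) = π (e * u)) (h : π (e * b) = π b) :
    π (e * (u * b * star u)) = π (u * b * star u) := by
  simp only [map_mul] at hu h ⊢
  rw [← mul_assoc, ← mul_assoc, ← hu, mul_assoc (π u), h]

variable [PartialOrder B] [StarOrderedRing B]

/-- One new relation is created at the bottom, and the old ones persist because `v` commutes with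
`(x - s₁)₊` for `s₁ = (j + 2) g - η`. The conjugated element becomes the first argument, so the
roles alternate. The margin `η` separates `t₀ < t < t₁` and puts `s₁` strictly below the level `(j +
2) g` of `x`. -/
lemma Interlaced.exists_descend (hπ : CStarKernel π) {x z e : B} {g η r : ℝ} {j : ℕ}
    (hx : 0 ≤ x) (hz : 0 ≤ z) (he : 0 ≤ e) (he1 : e ≤ 1) (hflip : HasFlips π e)
    (hex : π (e * x) = π x) (hez : π (e * z) = π z) (hr : 0 ≤ r) (hη : 0 < η)
    (hg : r + 2 * η < g) (hj : 1 ≤ j) (hzx : CutDownLE π r z x)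
    (h : Interlaced π g η x z (j + 1)) :
    ∃ v ∈ unitary B, π (v * e) = π (e * v) ∧ Interlaced π g η (v * z * star v) x j := by
  have hg0 : 0 < g := by linarith
  have hjr : (1 : ℝ) ≤ j := by exact_mod_cast hj
  have hs₀ : 0 < (j : ℝ) * g := by positivity
  obtain ⟨y, hy1, hy2⟩ := hzx ((j : ℝ) * g) ((j + 1) * g - 2 * η) hs₀ (by linarith)
  have h0 := (h 0).1
  push_cast at h0
  obtain ⟨v, hv, hve, hvp, hlev⟩ := exists_unitary_levelLE hπ (a := x) (b := z) (e := e) (y := y)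
    (s₀ := j * g) (s₁ := (j + 2) * g - η) (t₀ := (j + 1) * g - 2 * η) (t := (j + 1) * g - η)
    (t₁ := (j + 1) * g) hx hz he he1 hflip hex hez hs₀ (by linarith) (by linarith) (by linarith)
    (by linarith) (by convert h0 using 2 <;> ring) hy1 hy2
  refine ⟨v, hv, hve, fun k => ⟨?_, ?_⟩⟩
  · rcases k with _ | k
    · convert hlev using 2 <;> push_cast <;> ring
    · have h2 := (h k).2
      refine LevelLE.conj_left hπ (.of_nonneg hx) (.of_nonneg hz) hv hvp ?_ ?_
      · push_cast
        have : 0 ≤ (k : ℝ) * g := by positivity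
        linarith
      · convert h2 using 2 <;> push_cast <;> ring
  · have h1 := (h k).1
    refine LevelLE.conj_right hπ (.of_nonneg hx) (.of_nonneg hz) hv hvp (s₁ := (j + 2) * g - η) ?_ ?_
    · have : 0 ≤ (k : ℝ) * g := by positivity
      linarith
    · convert h1 using 2 <;> push_cast <;> ring

theorem exists_interlaced (hπ : CStarKernel π) {a b e : B} {g η r : ℝ}
    (ha : 0 ≤ a) (hb : 0 ≤ b) (he : 0 ≤ e) (he1 : e ≤ 1) (hflip : HasFlips π e)
    (hea : π (e * a) = π a) (heb : π (e * b) = π b) (hr : 0 ≤ r) (hη : 0 < η)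
    (hg : r + 2 * η < g) (hab : CutDownLE π r a b) (hba : CutDownLE π r b a) :
    ∃ u ∈ unitary B, ∃ w ∈ unitary B, π (u * e) = π (e * u) ∧ π (w * e) = π (e * w) ∧
      (Interlaced π g η (u * a * star u) (w * b * star w) 1 ∨
        Interlaced π g η (w * b * star w) (u * a * star u) 1) := by
  have hg0 : 0 < g := by linarith
  obtain ⟨N, hN⟩ := exists_nat_ge (max ‖a‖ ‖b‖ / g)
  rw [div_le_iff₀ hg0] at hN
  have hasa : IsSelfAdjoint a := .of_nonneg ha
  have hbsa : IsSelfAdjoint b := .of_nonneg hb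
  -- At `j = N + 1` every cut-down on the right of a level relation vanishes, since `N * g` exceeds
  -- both norms. Each of the `i` descents swaps the roles, hence the disjunction.
  have key : ∀ i : ℕ, ∀ j : ℕ, 1 ≤ j → j + i = N + 1 →
      ∃ u ∈ unitary B, ∃ w ∈ unitary B, π (u * e) = π (e * u) ∧ π (w * e) = π (e * w) ∧
      (Interlaced π g η (u * a * star u) (w * b * star w) j ∨
        Interlaced π g η (w * b * star w) (u * a * star u) j) := by
    intro i
    induction i with
    | zero =>
      intro j _ hj
      refine ⟨1, one_mem _, 1, one_mem _, by simp, by simp, Or.inl fun k => ?_⟩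
      have h1 : (j : ℝ) = N + 1 := by exact_mod_cast hj
      have h2 : 0 ≤ (k : ℝ) * g := by positivity
      have h3 := le_max_left ‖a‖ ‖b‖
      have h4 := le_max_right ‖a‖ ‖b‖
      simp only [one_mul, star_one, mul_one]
      exact ⟨levelLE_of_norm_le hasa (by rw [h1]; linarith),
        levelLE_of_norm_le hbsa (by rw [h1]; linarith)⟩
    | succ i ih =>
      intro j hj hij
      obtain ⟨u, hu, w, hw, hue, hwe, h⟩ := ih (j + 1) (by omega) (by omega)
      have ha' : 0 ≤ u * a * star u := star_right_conjugate_nonneg ha u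
      have hb' : 0 ≤ w * b * star w := star_right_conjugate_nonneg hb w
      have comm : ∀ v u : B, π (v * e) = π (e * v) → π (u * e) = π (e * u) →
          π (v * u * e) = π (e * (v * u)) := by
        intro v u h1 h2
        simp only [map_mul] at h1 h2 ⊢
        rw [mul_assoc, h2, ← mul_assoc, h1, mul_assoc]
      rcases h with h | h
      · obtain ⟨v, hv, hve, h'⟩ := h.exists_descend hπ ha' hb' he he1 hflip
          (conj_mem_unit hue hea) (conj_mem_unit hwe heb) hr hη hg hj
          (hba.conj hasa hbsa hw hu)
        refine ⟨u, hu, v * w, mul_mem hv hw, hue, comm v w hve hwe, Or.inr ?_⟩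
        simpa only [star_mul, mul_assoc] using h'
      · obtain ⟨v, hv, hve, h'⟩ := h.exists_descend hπ hb' ha' he he1 hflip
          (conj_mem_unit hwe heb) (conj_mem_unit hue hea) hr hη hg hj
          (hab.conj hbsa hasa hu hw)
        refine ⟨v * u, mul_mem hv hu, w, hw, comm v u hve hue, hwe, Or.inl ?_⟩
        simpa only [star_mul, mul_assoc] using h'
  exact key N 1 le_rfl (by omega)

/-! ### From interlaced levels to order and norm estimates. -/

/-- Interlaced levels give an operator inequality modulo the kernel. -/
lemma exists_le_add_of_levelLE (hπ : CStarKernel π) {x y : B} {s D : ℝ} (hx : IsSelfAdjoint x)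
    (hy : 0 ≤ y) (hD : 0 < D)
    (h : ∀ k : ℕ, LevelLE π x (s + D * k) y (D * (k + 1))) :
    ∃ j : B, π j = 0 ∧ x ≤ y + algebraMap ℝ B s + j := by
  have hysa : IsSelfAdjoint y := .of_nonneg hy
  -- Layer by layer: raising `k` by one adds `D • P` on the left and `D • R` on the right, where `P`
  -- and `R` are ramps of `x` and `y`. The level relation gives `RP = P` modulo the kernel, so `P`
  -- agrees with `RPR ≤ R² ≤ R` there; the defect `P - RPR` goes into `j`.
  have key : ∀ k : ℕ, ∃ j : B, π j = 0 ∧ cfc (fun z : ℝ => min z (s + D * k)) x ≤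
      cfc (fun z : ℝ => min z (D * k)) y + algebraMap ℝ B s + j := by
    intro k
    induction k with
    | zero =>
      refine ⟨0, map_zero π, ?_⟩
      have h1 : cfc (fun z : ℝ => min z (D * (0 : ℕ))) y = 0 := by
        rw [← cfc_const_zero ℝ y]
        refine cfc_congr fun z hz => ?_
        simpa using spectrum_nonneg_of_nonneg hy hz
      rw [h1, zero_add, add_zero]
      exact cfc_le_algebraMap _ _ _ fun z _ => by simp
    | succ k ih =>
      obtain ⟨j, hj, hle⟩ := ih
      have hlt1 : s + D * k < s + D * (k + 1) := by linarith
      have hlt2 : D * k < D * (k + 1) := by linarith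
      set P := cfc (ramp (s + D * k) (s + D * (k + 1))) x with hP
      set R := cfc (ramp (D * k) (D * (k + 1))) y with hR
      have hR0 : 0 ≤ R := cfc_ramp_nonneg y hlt2
      have hRsa : IsSelfAdjoint R := .of_nonneg hR0
      have hPsa : IsSelfAdjoint P := isSelfAdjoint_cfc _
      have e1 : ∀ (w : B) (c : ℝ), IsSelfAdjoint w → cfc (fun z : ℝ => min z (c + D * (k + 1))) w =
          cfc (fun z : ℝ => min z (c + D * k)) w +
            D • cfc (ramp (c + D * k) (c + D * (k + 1))) w := by
        intro w c hw
        have hcr := continuous_ramp (c + D * k) (c + D * (k + 1))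
        rw [← cfc_smul _ _ w, ← cfc_add w _ _]
        refine cfc_congr fun z _ => ?_
        have h5 : c + D * (k + 1) - (c + D * k) = D := by ring
        simp only [ramp, smul_eq_mul, h5]
        rcases le_total z (c + D * k) with h' | h'
        · rw [min_eq_left (by linarith), min_eq_left h', max_eq_right (by linarith)]; simp
        · rw [min_eq_right h', max_eq_left (by linarith)]
          rcases le_total z (c + D * (k + 1)) with h'' | h''
          · rw [min_eq_left h'', min_eq_right]
            · field_simp; ring
            · rw [div_le_one hD]; linarith
          · rw [min_eq_right h'', min_eq_left]
            · ring
            · rw [one_le_div hD]; linarith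
      have hRP : π R * π P = π P := by
        have : π ((1 - R) * P) = 0 := by
          rw [hR, hP, one_sub_cfc_ramp hysa hlt2, cfc_ramp_eq_max_sub_mul x hlt1]
          have h3 := h k
          unfold LevelLE at h3
          set c1 := cfc (fun z : ℝ => 1 / max (D * (k + 1) - D * k) (D * (k + 1) - z)) y
          set c2 := cfc (fun z : ℝ => max (D * (k + 1) - z) 0) y
          set c3 := cfc (fun z : ℝ => max (z - (s + D * k)) 0) x
          rw [show ∀ c4 : B, c1 * c2 * (c3 * c4) = c1 * (c2 * c3) * c4 by
            intro; simp only [mul_assoc], map_mul, map_mul, h3, mul_zero, zero_mul]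
        rw [sub_mul, one_mul, map_sub, map_mul, sub_eq_zero] at this
        exact this.symm
      have hPR : π P * π R = π P := by
        have := hπ.star_eq (x := R * P) (y := P) (by rw [map_mul, hRP])
        simpa [hRsa.star_eq, hPsa.star_eq] using this
      have h4 : R * P * R ≤ R := by
        have h5 : R * P * R ≤ R * 1 * R := by
          simpa [hRsa.star_eq] using
            star_left_conjugate_le_conjugate (cfc_ramp_le_one x (s + D * k) (s + D * (k + 1))) R
        refine h5.trans ?_
        rw [mul_one, hR]
        have hcr := continuous_ramp (D * k) (D * (k + 1))
        rw [← cfc_mul _ _ y hcr.continuousOn hcr.continuousOn]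
        refine cfc_mono (fun z _ => ?_) (hcr.mul hcr).continuousOn hcr.continuousOn
        exact mul_le_of_le_one_left (ramp_nonneg hlt2 z) (min_le_left _ _)
      have h6 : P ≤ R + (P - R * P * R) := by
        have := add_le_add_left h4 (P - R * P * R)
        simpa using this
      refine ⟨j + D • (P - R * P * R), ?_, ?_⟩
      · rw [map_add, hj, Algebra.smul_def, map_mul, map_sub, map_mul, map_mul, hRP, hPR, sub_self,
          mul_zero, add_zero]
      · have e2 := e1 x s hx
        have e3 := e1 y 0 hysa
        simp only [zero_add] at e3
        push_cast
        rw [e2, e3, ← hP, ← hR]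
        have h7 := add_le_add hle (smul_le_smul_of_nonneg_left h6 hD.le)
        refine h7.trans (le_of_eq ?_)
        rw [smul_add]
        abel
  obtain ⟨K, hK⟩ := exists_nat_ge ((‖x‖ + |s|) / D)
  rw [div_le_iff₀ hD] at hK
  obtain ⟨j, hj, hle⟩ := key K
  refine ⟨j, hj, ?_⟩
  have h1 : cfc (fun z : ℝ => min z (s + D * K)) x = x := by
    conv_rhs => rw [← cfc_id' ℝ x]
    refine cfc_congr fun z hz => min_eq_left ?_
    have := (abs_le.mp (abs_le_norm_of_mem_spectrum hx hz)).2
    have := neg_abs_le s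
    linarith
  have h2 : cfc (fun z : ℝ => min z (D * K)) y ≤ y := by
    conv_rhs => rw [← cfc_id' ℝ y]
    exact cfc_mono fun z _ => min_le_left _ _
  rw [h1] at hle
  refine hle.trans ?_
  gcongr

lemma Interlaced.exists_le_add (hπ : CStarKernel π) {x z : B} {g η : ℝ} (hx : 0 ≤ x)
    (hz : 0 ≤ z) (hη : 0 < η) (hg : η < g) (h : Interlaced π g η x z 1) :
    (∃ j : B, π j = 0 ∧ x ≤ z + algebraMap ℝ B (4 * g) + j) ∧
      ∃ j : B, π j = 0 ∧ z ≤ x + algebraMap ℝ B (4 * g) + j := by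
  have hg0 : 0 < g := by linarith
  constructor
  -- Levels of one element recur in steps of `2g`. Those of `z` are odd multiples of `g`, while the
  -- layers must end at multiples of `2g`; so the lowest relation is discarded and the level `(2k +
  -- 3) g` is weakened to `(2k + 2) g`. In the other direction the levels already fit, with shift
  -- `3g - η`.
  · obtain ⟨j, hj, hle⟩ := exists_le_add_of_levelLE hπ (s := 4 * g - η) (D := 2 * g)
      (IsSelfAdjoint.of_nonneg hx) hz (by linarith) (fun k => by
        have := (h (k + 1)).1
        push_cast at this
        have h2 := this.mono (t' := 2 * g * (k + 1)) (by linarith)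
        rwa [show (1 + 2 * ((k : ℝ) + 1) + 1) * g - η = 4 * g - η + 2 * g * k by ring] at h2)
    refine ⟨j, hj, hle.trans ?_⟩
    gcongr
    linarith
  · obtain ⟨j, hj, hle⟩ := exists_le_add_of_levelLE hπ (s := 3 * g - η) (D := 2 * g)
      (IsSelfAdjoint.of_nonneg hz) hx (by linarith) (fun k => by
        have := (h k).2
        push_cast at this
        rwa [show (1 + 2 * (k : ℝ) + 2) * g - η = 3 * g - η + 2 * g * k by ring,
          show (1 + 2 * (k : ℝ) + 1) * g = 2 * g * (k + 1) by ring] at this)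
    refine ⟨j, hj, hle.trans ?_⟩
    gcongr
    linarith

end Chain

/-! ### Bounded sequences modulo null sequences. -/

/-- The C⋆-algebra of bounded sequences in `M`. -/
def BddSeq (M : Type*) [CStarAlgebra M] : Type _ := BoundedContinuousFunction ℕ M

namespace BddSeq

variable {M : Type*} [CStarAlgebra M]

noncomputable instance : CStarAlgebra (BddSeq M) :=
  inferInstanceAs (CStarAlgebra (BoundedContinuousFunction ℕ M))

noncomputable instance : PartialOrder (BddSeq M) := CStarAlgebra.spectralOrder (BddSeq M)

instance : StarOrderedRing (BddSeq M) := CStarAlgebra.spectralOrderedRing (BddSeq M)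

/-- The bounded sequence with given terms. -/
noncomputable def mk (f : ℕ → M) (C : ℝ) (h : ∀ n, ‖f n‖ ≤ C) : BddSeq M :=
  BoundedContinuousFunction.ofNormedAddCommGroupDiscrete f C h

/-- The evaluation of a bounded sequence at `n`. -/
noncomputable def eval (n : ℕ) : BddSeq M →⋆ₐ[ℂ] M where
  toFun x := (show BoundedContinuousFunction ℕ M from x) n
  map_one' := rfl
  map_mul' _ _ := rfl
  map_zero' := rfl
  map_add' _ _ := rfl
  commutes' _ := rfl
  map_star' _ := rfl

@[simp] lemma eval_mk (f : ℕ → M) (C : ℝ) (h : ∀ n, ‖f n‖ ≤ C) (n : ℕ) :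
    eval n (mk f C h) = f n := rfl

lemma ext {x y : BddSeq M} (h : ∀ n, eval n x = eval n y) : x = y :=
  BoundedContinuousFunction.ext h

lemma norm_eval_le (x : BddSeq M) (n : ℕ) : ‖eval n x‖ ≤ ‖x‖ :=
  BoundedContinuousFunction.norm_coe_le_norm (show BoundedContinuousFunction ℕ M from x) n

lemma norm_le {x : BddSeq M} {C : ℝ} (hC : 0 ≤ C) (h : ∀ n, ‖eval n x‖ ≤ C) : ‖x‖ ≤ C :=
  (BoundedContinuousFunction.norm_le hC).mpr h

lemma eval_cfc {x : BddSeq M} (hx : IsSelfAdjoint x) {f : ℝ → ℝ} (hf : Continuous f) (n : ℕ) :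
    eval n (cfc f x) = cfc f (eval n x) := map_cfc_of_continuous (eval n) hx hf

lemma isSelfAdjoint_of_eval {x : BddSeq M} (h : ∀ n, IsSelfAdjoint (eval n x)) :
    IsSelfAdjoint x := ext fun n => by rw [map_star]; exact h n

lemma eval_mem_unitary {u : BddSeq M} (hu : u ∈ unitary (BddSeq M)) (n : ℕ) :
    eval n u ∈ unitary M := by
  rw [Unitary.mem_iff] at hu ⊢
  rw [← map_star, ← map_mul, ← map_mul, hu.1, hu.2, map_one]
  exact ⟨rfl, rfl⟩

lemma norm_unitary_le {u : M} (hu : u ∈ unitary M) : ‖u‖ ≤ 1 := by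
  nontriviality M
  exact (CStarRing.norm_of_mem_unitary hu).le

/-- A sequence of unitaries, as a bounded sequence. -/
noncomputable def unitarySeq (u : ℕ → M) (hu : ∀ n, u n ∈ unitary M) : BddSeq M :=
  mk u 1 fun n => norm_unitary_le (hu n)

lemma unitarySeq_mem (u : ℕ → M) (hu : ∀ n, u n ∈ unitary M) :
    unitarySeq u hu ∈ unitary (BddSeq M) := by
  rw [Unitary.mem_iff]
  constructor <;> refine ext fun n => ?_
  · rw [map_mul, map_star, map_one]; exact (Unitary.mem_iff.mp (hu n)).1
  · rw [map_mul, map_star, map_one]; exact (Unitary.mem_iff.mp (hu n)).2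

/-- The ideal of sequences that converge to zero. -/
noncomputable def nullIdeal (M : Type*) [CStarAlgebra M] : Ideal (BddSeq M) where
  carrier := {x | Tendsto (fun n => eval n x) atTop (𝓝 0)}
  add_mem' {x y} hx hy := by simpa using Tendsto.add hx hy
  zero_mem' := by simp
  smul_mem' c x hx := by
    rw [Set.mem_ofPred_eq, tendsto_zero_iff_norm_tendsto_zero] at hx ⊢
    refine squeeze_zero (fun _ => norm_nonneg _) (fun n => ?_)
      (by simpa using hx.const_mul ‖c‖)
    rw [smul_eq_mul, map_mul]
    exact (norm_mul_le _ _).trans (by gcongr; exact norm_eval_le c n)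

instance : (nullIdeal M).IsTwoSided where
  mul_mem_of_left {x} c hx := by
    change Tendsto _ _ _ at hx
    change Tendsto (fun n => eval n (x * c)) _ _
    rw [tendsto_zero_iff_norm_tendsto_zero] at hx ⊢
    refine squeeze_zero (fun _ => norm_nonneg _) (fun n => ?_)
      (by simpa using hx.mul_const ‖c‖)
    rw [map_mul]
    exact (norm_mul_le _ _).trans (by gcongr; exact norm_eval_le c n)

/-- The quotient map onto the bounded sequences modulo the null sequences. -/
noncomputable abbrev toQuotient (M : Type*) [CStarAlgebra M] : BddSeq M →+* BddSeq M ⧸ nullIdeal M :=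
  Ideal.Quotient.mk (nullIdeal M)

lemma toQuotient_eq_zero {x : BddSeq M} :
    toQuotient M x = 0 ↔ Tendsto (fun n => ‖eval n x‖) atTop (𝓝 0) := by
  rw [← tendsto_zero_iff_norm_tendsto_zero]
  exact Ideal.Quotient.eq_zero_iff_mem

lemma toQuotient_eq {x y : BddSeq M} :
    toQuotient M x = toQuotient M y ↔
      Tendsto (fun n => ‖eval n x - eval n y‖) atTop (𝓝 0) := by
  rw [← sub_eq_zero, ← map_sub, toQuotient_eq_zero]
  simp only [map_sub]

lemma cstarKernel : CStarKernel (toQuotient M) where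
  closed := by
    refine isClosed_of_closure_subset fun x hx => ?_
    rw [Set.mem_ofPred_eq, toQuotient_eq_zero, Metric.tendsto_atTop]
    intro ε hε
    obtain ⟨y, hy, hxy⟩ := Metric.mem_closure_iff.mp hx (ε / 2) (half_pos hε)
    obtain ⟨N, hN⟩ := Metric.tendsto_atTop.mp (toQuotient_eq_zero.mp hy) (ε / 2) (half_pos hε)
    refine ⟨N, fun n hn => ?_⟩
    have h1 := hN n hn
    rw [dist_zero_right, norm_norm] at h1 ⊢
    have h2 := norm_eval_le (x - y) n
    rw [map_sub] at h2
    rw [dist_eq_norm] at hxy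
    have h3 := norm_add_le (eval n x - eval n y) (eval n y)
    rw [sub_add_cancel] at h3
    linarith
  star_mem x hx := by
    rw [toQuotient_eq_zero] at hx ⊢
    simpa only [map_star, norm_star] using hx
  eq_zero_of_star_mul_self x hx := by
    rw [toQuotient_eq_zero] at hx ⊢
    simp only [map_mul, map_star, CStarRing.norm_star_mul_self] at hx
    have h := hx.sqrt
    simpa only [Real.sqrt_mul_self (norm_nonneg _), Real.sqrt_zero] using h

end BddSeq

/-- Near-minimizers of nonnegative functions whose infima tend to zero. -/
lemma exists_seq_tendsto_zero {X : Type*} [Nonempty X] (φ : ℕ → X → ℝ) (hφ : ∀ n x, 0 ≤ φ n x)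
    (h : ∀ ε > 0, ∀ᶠ n in atTop, ∃ x, φ n x < ε) :
    ∃ x : ℕ → X, Tendsto (fun n => φ n (x n)) atTop (𝓝 0) := by
  have hbdd : ∀ n, BddBelow (Set.range (φ n)) := fun n => ⟨0, by rintro _ ⟨x, rfl⟩; exact hφ n x⟩
  have key : ∀ n : ℕ, ∃ x, φ n x < (⨅ x, φ n x) + 1 / ((n : ℝ) + 1) := fun n =>
    exists_lt_of_ciInf_lt (lt_add_of_pos_right _ Nat.one_div_pos_of_nat)
  choose x hx using key
  refine ⟨x, Metric.tendsto_atTop.mpr fun ε hε => ?_⟩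
  obtain ⟨N, hN⟩ := eventually_atTop.mp ((h (ε / 2) (half_pos hε)).and
    ((tendsto_one_div_add_atTop_nhds_zero_nat (𝕜 := ℝ)).eventually_lt_const (half_pos hε)))
  refine ⟨N, fun n hn => ?_⟩
  obtain ⟨⟨y, hy⟩, h2⟩ := hN n hn
  rw [dist_zero_right, Real.norm_of_nonneg (hφ _ _)]
  have := hx n
  have := ciInf_le (hbdd n) y
  linarith

lemma ramp_eq_zero {s t z : ℝ} (h : z ≤ s) : ramp s t z = 0 := by
  rw [ramp, max_eq_right (by linarith)]; simp

lemma ramp_eq_one {s t z : ℝ} (hst : s < t) (h : t ≤ z) : ramp s t z = 1 := by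
  rw [ramp, max_eq_left (by linarith), min_eq_left]
  rw [one_le_div (by linarith)]; linarith

lemma abs_ramp_sub_le {θ z : ℝ} (h0 : 0 < θ) (h1 : θ < 1) (hz0 : 0 ≤ z) (hz1 : z ≤ 1) :
    |ramp 0 (1 - θ) z - z| ≤ θ := by
  have h2 : 0 < 1 - θ := by linarith
  rcases le_total (1 - θ) z with h | h
  · rw [ramp_eq_one h2 h, abs_of_nonneg (by linarith)]; linarith
  · have : ramp 0 (1 - θ) z = z / (1 - θ) := by
      simp only [ramp, sub_zero]
      rw [max_eq_left hz0, min_eq_right]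
      rw [div_le_one h2]; exact h
    have h3 : z / (1 - θ) ≤ 1 := by rw [div_le_one h2]; exact h
    have h4 : z / (1 - θ) * (1 - θ) = z := div_mul_cancel₀ _ h2.ne'
    have h5 : 0 ≤ z / (1 - θ) := by positivity
    rw [this, abs_of_nonneg (by nlinarith)]
    nlinarith

lemma commute_cfc_self {M : Type*} [CStarAlgebra M] (f g : ℝ → ℝ) (a : M) :
    cfc f a * cfc g a = cfc g a * cfc f a := (cfc_commute_cfc f g a).eq

/-! ### Exact flips from property (I). -/

/-- An embedding of `A` onto a hereditary subalgebra of the unital algebra `M`, such that `x⋆x + e`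
and `xx⋆ + e` are approximately unitarily equivalent in `M` whenever `e` is a unit for `x`. -/
structure FlipEmbedding {A M : Type*} [NonUnitalCStarAlgebra A] [PartialOrder A]
    [CStarAlgebra M] (ι : A →⋆ₙₐ[ℂ] M) : Prop where
  injective : Function.Injective ι
  hereditary : ∀ (a b : A) (m : M), ∃ c, ι c = ι a * m * ι b
  flip : ∀ x e : A, 0 ≤ e → ‖e‖ ≤ 1 → e * x = x → x * e = x → ∀ ε > 0, ∃ u ∈ unitary M,
    ‖star u * ι (star x * x + e) * u - ι (x * star x + e)‖ < ε

namespace FlipEmbedding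

variable {A M : Type*} [NonUnitalCStarAlgebra A] [CStarAlgebra M] {ι : A →⋆ₙₐ[ℂ] M}

lemma map_cfcₙ {a : A} (ha : IsSelfAdjoint a) {f : ℝ → ℝ} (hf : Continuous f)
    (h0 : f 0 = 0) : ι (cfcₙ f a) = cfc f (ι a) := by
  have hc : Continuous ι := map_continuous ι
  have h := NonUnitalStarAlgHom.map_cfcₙ (R := ℝ) (S := ℂ) ι f a hf.continuousOn h0 hc ha
    (ha.map ι)
  rw [h]
  exact cfcₙ_eq_cfc hf.continuousOn h0

variable [PartialOrder A]

lemma norm_map (hι : FlipEmbedding ι) (a : A) : ‖ι a‖ = ‖a‖ :=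
  NonUnitalStarAlgHom.norm_map ι hι.injective a

lemma isSelfAdjoint_of_map (hι : FlipEmbedding ι) {a : A} (h : IsSelfAdjoint (ι a)) :
    IsSelfAdjoint a := hι.injective (by rw [map_star]; exact h)

variable [StarOrderedRing A]

open BddSeq

/-- Flipping modulo null sequences, with a unit that is moved by at most `3 * θ`. -/
lemma exists_approx_flip (hι : FlipEmbedding ι) {H x : BddSeq M} {k : ℕ → A}
    (hk : ∀ n, ι (k n) = eval n H) (hk0 : ∀ n, 0 ≤ k n)
    (hHx : toQuotient M (H * x) = toQuotient M x) (hxH : toQuotient M (x * H) = toQuotient M x)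
    (hH0 : 0 ≤ H) (hH1 : H ≤ 1)
    {θ : ℝ} (h0 : 0 < θ) (h1 : θ < 1) :
    ∃ u ∈ unitary (BddSeq M),
      toQuotient M (star u * (star x * x) * u) = toQuotient M (x * star x) ∧
        ∀ᶠ n in atTop, ‖star (eval n u) * eval n H * eval n u - eval n H‖ < 3 * θ := by
  set π := toQuotient M with hπdef
  have hπ : CStarKernel π := cstarKernel
  have hHsa : IsSelfAdjoint H := .of_nonneg hH0
  have h2 : 0 < 1 - θ := by linarith
  have h3 : 1 - θ < 1 := by linarith
  -- Property (I) needs an exact unit, while `H` is a unit for `x` only modulo null sequences. Since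
  -- `1 - D` is a multiple of `1 - H`, replacing `x` by `DxD` does not change its class, and `ED =
  -- D` makes `E` an exact unit for it. The price is that `E` differs from `H` by at most `θ`.
  set E := cfc (ramp 0 (1 - θ)) H with hE
  set D := cfc (ramp (1 - θ) 1) H with hD
  have hE0 : 0 ≤ E := cfc_ramp_nonneg H h2
  have hE1 : E ≤ 1 := cfc_ramp_le_one H _ _
  have hEsa : IsSelfAdjoint E := .of_nonneg hE0
  have hDsa : IsSelfAdjoint D := isSelfAdjoint_cfc _
  have hED : E * D = D := by
    refine (cfc_eq_mul (continuous_ramp _ _) (continuous_ramp _ _) fun z _ => ?_).symm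
    rcases le_total z (1 - θ) with h | h
    · rw [ramp_eq_zero h, mul_zero]
    · rw [ramp_eq_one h2 h, one_mul]
  have hDE : D * E = D := by rw [hD, hE, commute_cfc_self, ← hD, ← hE, hED]
  have hpart : cfc (fun z : ℝ => max (1 - z) 0) H = 1 - H := by
    have : 1 - H = cfc (fun z : ℝ => 1 - z) H := by
      conv_lhs => rw [← cfc_id' ℝ H]
      rw [one_sub_cfc hHsa (f := fun z : ℝ => z) (by fun_prop)]
    rw [this]
    refine cfc_congr fun z hz => max_eq_left ?_
    have := (CFC.le_one_iff H).mp hH1 z hz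
    linarith
  have hDx : π (D * x) = π x := by
    have : π ((1 - D) * x) = 0 := by
      rw [hD, one_sub_cfc_ramp hHsa h3, hpart, mul_assoc, map_mul, sub_mul, one_mul, map_sub π x,
        hHx, sub_self, mul_zero]
    rw [sub_mul, one_mul, map_sub, sub_eq_zero] at this
    exact this.symm
  have hxD : π (x * D) = π x := by
    have : π (x * (1 - D)) = 0 := by
      rw [hD, one_sub_cfc_ramp hHsa h3, commute_cfc_self, hpart, ← mul_assoc, map_mul, mul_sub, mul_one, map_sub π x,
        hxH, sub_self, zero_mul]
    rw [mul_sub, mul_one, map_sub, sub_eq_zero] at this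
    exact this.symm
  set x' := D * x * D with hx'
  have hx'x : π x' = π x := by rw [hx', map_mul, hDx, ← map_mul, hxD]
  have hEx' : E * x' = x' := by rw [hx', ← mul_assoc, ← mul_assoc, hED]
  have hx'E : x' * E = x' := by rw [hx', mul_assoc, hDE]
  -- the sequences in `A`
  have hEn : ∀ n, ι (cfcₙ (ramp 0 (1 - θ)) (k n)) = eval n E := fun n => by
    rw [map_cfcₙ (.of_nonneg (hk0 n)) (continuous_ramp _ _) (ramp_eq_zero le_rfl), hk,
      eval_cfc hHsa (continuous_ramp _ _)]
  have hDn : ∀ n, ι (cfcₙ (ramp (1 - θ) 1) (k n)) = eval n D := fun n => by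
    rw [map_cfcₙ (.of_nonneg (hk0 n)) (continuous_ramp _ _) (ramp_eq_zero h2.le), hk,
      eval_cfc hHsa (continuous_ramp _ _)]
  have hX : ∀ n, ∃ c, ι c = eval n x' := fun n => by
    obtain ⟨c, hc⟩ := hι.hereditary (cfcₙ (ramp (1 - θ) 1) (k n)) (cfcₙ (ramp (1 - θ) 1) (k n))
      (eval n x)
    exact ⟨c, by rw [hc, hDn, hx', map_mul, map_mul]⟩
  choose X hXn using hX
  -- Property (I) is applied in `A` term by term, with error tolerance `1 / (n + 1)`.
  have hflip : ∀ n : ℕ, ∃ u ∈ unitary M, ‖star u * eval n (star x' * x' + E) * u -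
      eval n (x' * star x' + E)‖ < 1 / ((n : ℝ) + 1) := by
    intro n
    obtain ⟨u, hu, hlt⟩ := hι.flip (X n) (cfcₙ (ramp 0 (1 - θ)) (k n))
      (cfcₙ_nonneg fun z _ => ramp_nonneg h2 z)
      (norm_cfcₙ_le fun z _ => by
        rw [Real.norm_of_nonneg (ramp_nonneg h2 z)]; exact min_le_left _ _)
      (hι.injective (by rw [map_mul, hEn, hXn, ← map_mul, hEx']))
      (hι.injective (by rw [map_mul, hEn, hXn, ← map_mul, hx'E]))
      (1 / ((n : ℝ) + 1)) Nat.one_div_pos_of_nat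
    refine ⟨u, hu, ?_⟩
    simp only [map_add, map_mul, map_star, hXn, hEn] at hlt ⊢
    exact hlt
  choose w hw hwlt using hflip
  set u := unitarySeq w hw with hu
  have humem : u ∈ unitary (BddSeq M) := unitarySeq_mem w hw
  have husmem : star u ∈ unitary (BddSeq M) := Unitary.star_mem humem
  have hflip' : π (star u * (star x' * x' + E) * star (star u)) = π (x' * star x' + E) := by
    rw [hπdef, toQuotient_eq]
    refine squeeze_zero (fun _ => norm_nonneg _) (fun n => ?_)
      (tendsto_one_div_add_atTop_nhds_zero_nat (𝕜 := ℝ))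
    refine le_trans (le_of_eq ?_) (hwlt n).le
    rw [star_star, map_mul, map_mul, map_star, hu]
    rfl
  have hp1 : 0 ≤ star x' * x' := star_mul_self_nonneg x'
  have hp2 : 0 ≤ x' * star x' := mul_star_self_nonneg x'
  have hsep1 : π (cfc (fun z : ℝ => max (z - 1) 0) (E + star x' * x')) = π (star x' * x') :=
    hπ.cfc_posPart_add hp1 hEsa hE1 (by
      have := congrArg star hx'E
      rw [star_mul, hEsa.star_eq] at this
      rw [← mul_assoc, this])
  have hsep2 : π (cfc (fun z : ℝ => max (z - 1) 0) (E + x' * star x')) = π (x' * star x') :=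
    hπ.cfc_posPart_add hp2 hEsa hE1 (by rw [← mul_assoc, hEx'])
  have hsa1 : IsSelfAdjoint (E + star x' * x') := hEsa.add (.of_nonneg hp1)
  have hsa2 : IsSelfAdjoint (E + x' * star x') := hEsa.add (.of_nonneg hp2)
  rw [add_comm (star x' * x'), add_comm (x' * star x')] at hflip'
  have hxx : π (star u * (star x' * x') * star (star u)) = π (x' * star x') := by
    have h4 := hπ.cfc_eq (f := fun z : ℝ => max (z - 1) 0) (isSelfAdjoint_conj hsa1 (star u))
      hsa2 hflip' (by fun_prop)
    rw [hsep2, cfc_conj_unitary husmem hsa1 (by fun_prop), map_mul, map_mul, hsep1] at h4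
    rw [map_mul, map_mul, h4]
  have hEE : π (star u * E * star (star u)) = π E := by
    rw [mul_add, add_mul, map_add, map_add, hxx] at hflip'
    exact add_right_cancel hflip'
  refine ⟨u, humem, ?_, ?_⟩
  · rw [star_star] at hxx
    have hsx := hπ.star_eq hx'x
    have e1 : π (star x' * x') = π (star x * x) := by rw [map_mul, hsx, hx'x, map_mul]
    have e2 : π (x' * star x') = π (x * star x) := by rw [map_mul, hsx, hx'x, map_mul]
    rw [← e2, ← hxx]
    simp only [map_mul] at e1 ⊢
    rw [e1]
  · rw [star_star, hπdef, toQuotient_eq] at hEE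
    filter_upwards [hEE.eventually_lt_const h0] with n hn
    rw [map_mul, map_mul, map_star] at hn
    have hdiff : ‖eval n E - eval n H‖ ≤ θ := by
      rw [← map_sub]
      refine (norm_eval_le _ n).trans ?_
      have : E - H = cfc (fun z : ℝ => ramp 0 (1 - θ) z - z) H := by
        rw [cfc_sub _ _ H (continuous_ramp _ _).continuousOn (by fun_prop), cfc_id' ℝ H]
      rw [this]
      refine norm_cfc_le h0.le fun z hz => ?_
      exact abs_ramp_sub_le h0 h1 (spectrum_nonneg_of_nonneg hH0 hz)
        ((CFC.le_one_iff H).mp hH1 z hz)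
    set U := eval n u
    have hU : U ∈ unitary M := eval_mem_unitary humem n
    -- The bound `3 * θ`: the distance from `E` to `H` enters twice, and `E` itself is eventually
    -- moved by less than `θ`.
    have e3 : star U * eval n H * U - eval n H = star U * (eval n H - eval n E) * U +
        (star U * eval n E * U - eval n E) + (eval n E - eval n H) := by noncomm_ring
    have e4 : ‖star U * (eval n H - eval n E) * U‖ = ‖eval n E - eval n H‖ := by
      rw [CStarRing.norm_mul_mem_unitary _ hU,
        CStarRing.norm_mem_unitary_mul _ (Unitary.star_mem hU), norm_sub_rev]
    rw [e3]
    refine lt_of_le_of_lt (norm_add₃_le) ?_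
    rw [e4]
    linarith

/-- For each fixed `θ` a flip is available that moves the unit by less than `3θ`. Choosing in each
term a near-minimizer of the sum of the two errors is a diagonal argument that yields one sequence
of unitaries with both errors tending to zero. -/
theorem hasFlips (hι : FlipEmbedding ι) {e : BddSeq M} (he : ∀ n, ∃ a, ι a = eval n e)
    (he0 : 0 ≤ e) : HasFlips (toQuotient M) e := by
  intro h x hh0 hh1 heh hhx hxh
  have hπ : CStarKernel (toQuotient M) := cstarKernel
  have hesa : IsSelfAdjoint e := .of_nonneg he0
  have hhsa : IsSelfAdjoint h := .of_nonneg hh0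
  -- The terms of `h` need not come from `A`; those of `ehe` do, by heredity, and the class is the
  -- same. Applying `ramp 0 1` then gives a positive contraction without changing the class.
  obtain ⟨h₁, hsa₁, hA₁, heq₁⟩ : ∃ h₁ : BddSeq M, IsSelfAdjoint h₁ ∧
      (∀ n, ∃ a, ι a = eval n h₁) ∧ toQuotient M h₁ = toQuotient M h := by
    rcases heh with rfl | heh
    · exact ⟨h, hhsa, he, rfl⟩
    · refine ⟨e * h * e, by simpa [hesa.star_eq] using isSelfAdjoint_conj hhsa e, fun n => ?_, ?_⟩
      · obtain ⟨a, ha⟩ := he n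
        obtain ⟨c, hc⟩ := hι.hereditary a a (eval n h)
        exact ⟨c, by rw [hc, ha, map_mul, map_mul]⟩
      · have h2 := hπ.star_eq heh
        rw [star_mul, hesa.star_eq, hhsa.star_eq] at h2
        rw [map_mul, heh, ← map_mul, h2]
  choose a ha using hA₁
  have hasa : ∀ n, IsSelfAdjoint (a n) := fun n =>
    hι.isSelfAdjoint_of_map (by rw [ha]; exact hsa₁.map (eval n))
  have hr0 : ramp 0 1 0 = 0 := ramp_eq_zero le_rfl
  have hrc := continuous_ramp 0 1
  set H := cfc (ramp 0 1) h₁ with hH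
  have hHh : toQuotient M H = toQuotient M h := by
    rw [hH, hπ.cfc_eq hsa₁ hhsa heq₁ hrc]
    congr 1
    conv_rhs => rw [← cfc_id' ℝ h]
    refine cfc_congr fun z hz => ?_
    have hz0 := spectrum_nonneg_of_nonneg hh0 hz
    have hz1 := (CFC.le_one_iff h).mp hh1 z hz
    simp [ramp, hz0, hz1]
  have hHx : toQuotient M (H * x) = toQuotient M x := by rw [map_mul, hHh, ← map_mul, hhx]
  have hxH : toQuotient M (x * H) = toQuotient M x := by rw [map_mul, hHh, ← map_mul, hxh]
  have hkey := fun (θ : ℝ) (h0 : 0 < θ) (h1 : θ < 1) =>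
    hι.exists_approx_flip (H := H) (x := x) (k := fun n => cfcₙ (ramp 0 1) (a n))
      (fun n => by rw [map_cfcₙ (hasa n) hrc hr0, ha, hH, eval_cfc hsa₁ hrc])
      (fun n => cfcₙ_nonneg fun z _ => ramp_nonneg one_pos z)
      hHx hxH (cfc_ramp_nonneg _ one_pos) (cfc_ramp_le_one _ _ _) h0 h1
  obtain ⟨w, hw⟩ := exists_seq_tendsto_zero (X := unitary M)
    (fun n u => ‖star (u : M) * (star (eval n x) * eval n x) * u - eval n x * star (eval n x)‖ +
      ‖star (u : M) * eval n H * u - eval n H‖) (fun n u => by positivity) (fun ε hε => by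
      obtain ⟨u, hu, h1, h2⟩ := hkey (min (ε / 6) (1 / 2)) (by positivity)
        (lt_of_le_of_lt (min_le_right _ _) (by norm_num))
      rw [toQuotient_eq] at h1
      filter_upwards [h1.eventually_lt_const (half_pos hε), h2] with n h3 h4
      refine ⟨⟨eval n u, eval_mem_unitary hu n⟩, ?_⟩
      simp only [map_mul, map_star] at h3
      have := min_le_left (ε / 6) (1 / 2)
      simp only
      linarith)
  have hu := unitarySeq_mem (fun n => (w n : M)) fun n => (w n).2
  set u := unitarySeq (fun n => (w n : M)) fun n => (w n).2
  refine ⟨star u, Unitary.star_mem hu, ?_, ?_⟩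
  · rw [star_star, toQuotient_eq]
    refine squeeze_zero (fun _ => norm_nonneg _) (fun n => ?_) hw
    simp only [map_mul, map_star]
    exact le_add_of_nonneg_right (norm_nonneg _)
  · have h5 : toQuotient M (star u * H * u) = toQuotient M H := by
      rw [toQuotient_eq]
      refine squeeze_zero (fun _ => norm_nonneg _) (fun n => ?_) hw
      simp only [map_mul, map_star]
      exact le_add_of_nonneg_left (norm_nonneg _)
    have h6 : toQuotient M (star u * H) = toQuotient M (H * star u) := by
      rw [map_mul _ H, ← h5, ← map_mul, mul_assoc _ u, (Unitary.mem_iff.mp hu).2, mul_one]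
    simpa only [map_mul, hHh] using h6

end FlipEmbedding

namespace BddSeq

variable {M : Type*} [CStarAlgebra M]

/-- The constant sequence. -/
noncomputable def const (x : M) : BddSeq M := mk (fun _ => x) ‖x‖ fun _ => le_rfl

@[simp] lemma eval_const (x : M) (n : ℕ) : eval n (const x) = x := rfl

lemma eval_mono [PartialOrder M] [StarOrderedRing M] {x y : BddSeq M} (h : x ≤ y) (n : ℕ) :
    eval n x ≤ eval n y := by
  rw [← sub_nonneg, ← map_sub]
  obtain ⟨c, hc⟩ := CStarAlgebra.nonneg_iff_eq_star_mul_self.mp (sub_nonneg.mpr h)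
  rw [hc, map_mul, map_star]
  exact star_mul_self_nonneg _

end BddSeq

lemma norm_sub_le_of_le_add {M : Type*} [CStarAlgebra M] [PartialOrder M] [StarOrderedRing M]
    {x z j k : M} {c δ : ℝ} (hc : 0 ≤ c) (h1 : x ≤ z + algebraMap ℝ M c + j)
    (h2 : z ≤ x + algebraMap ℝ M c + k) (hj : ‖j‖ ≤ δ) (hk : ‖k‖ ≤ δ)
    (hx : IsSelfAdjoint x) (hz : IsSelfAdjoint z) : ‖x - z‖ ≤ c + δ := by
  have hδ : 0 ≤ δ := (norm_nonneg _).trans hj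
  have key : ∀ x z j : M, IsSelfAdjoint x → IsSelfAdjoint z → x ≤ z + algebraMap ℝ M c + j →
      ‖j‖ ≤ δ → x - z ≤ algebraMap ℝ M (c + δ) := by
    intro x z j hx hz h hj
    -- Self-adjointness of the error is forced by the inequality that contains it.
    have hsa : IsSelfAdjoint j := by
      have h3 : IsSelfAdjoint (z + algebraMap ℝ M c + j - x) := .of_nonneg (sub_nonneg.mpr h)
      have h4 : j = (z + algebraMap ℝ M c + j - x) + x - z - algebraMap ℝ M c := by abel
      rw [h4]
      exact ((h3.add hx).sub hz).sub ((IsSelfAdjoint.all c).algebraMap M)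
    have h5 : j ≤ algebraMap ℝ M δ :=
      hsa.le_algebraMap_norm_self.trans (algebraMap_mono M hj)
    rw [sub_le_iff_le_add', map_add, ← add_assoc]
    exact h.trans (by gcongr)
  have hsa := hx.sub hz
  have hle := key x z j hx hz h1 hj
  have hge : algebraMap ℝ M (-(c + δ)) ≤ x - z := by
    rw [map_neg, neg_le, neg_sub]
    exact key z x k hz hx h2 hk
  rw [← cfc_id' ℝ (x - z)]
  refine norm_cfc_le (by positivity) fun t ht => ?_
  rw [Real.norm_eq_abs, abs_le]
  exact ⟨(algebraMap_le_iff_le_spectrum (a := x - z) hsa).mp hge t ht,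
    (le_algebraMap_iff_spectrum_le (a := x - z) hsa).mp hle t ht⟩

/-! ### Conjugating `b` close to `a` and returning to `A`. -/

namespace FlipEmbedding

variable {A M : Type*} [NonUnitalCStarAlgebra A] [PartialOrder A] [StarOrderedRing A]
  [CStarAlgebra M] {ι : A →⋆ₙₐ[ℂ] M}

open BddSeq

lemma const_map_nonneg (ι : A →⋆ₙₐ[ℂ] M) {a : A} (ha : 0 ≤ a) : 0 ≤ const (ι a) := by
  obtain ⟨c, rfl⟩ := CStarAlgebra.nonneg_iff_eq_star_mul_self.mp ha
  have : const (ι (star c * c)) = star (const (ι c)) * const (ι c) :=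
    BddSeq.ext fun n => by simp [map_star]
  rw [this]
  exact star_mul_self_nonneg _

lemma map_nonneg' [PartialOrder M] [StarOrderedRing M] (ι : A →⋆ₙₐ[ℂ] M) {a : A} (ha : 0 ≤ a) :
    0 ≤ ι a := by
  obtain ⟨c, rfl⟩ := CStarAlgebra.nonneg_iff_eq_star_mul_self.mp ha
  rw [map_mul, map_star]
  exact star_mul_self_nonneg _

/-- Replacing `x` by the larger `s` leaves a function of `s`, namely `(1 - ramp 0 δ z)² z`, which is
at most `z` on `[0, δ]` and zero beyond. -/
lemma norm_one_sub_ramp_mul_mul_le {M : Type*} [CStarAlgebra M] [PartialOrder M]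
    [StarOrderedRing M] {x s : M} (hx : 0 ≤ x) (hxs : x ≤ s) {δ : ℝ} (hδ : 0 < δ) :
    ‖(1 - cfc (ramp 0 δ) s) * x * star (1 - cfc (ramp 0 δ) s)‖ ≤ δ := by
  have hs : 0 ≤ s := hx.trans hxs
  have hssa : IsSelfAdjoint s := .of_nonneg hs
  have hrc := continuous_ramp 0 δ
  have h1 := star_right_conjugate_le_conjugate hxs (1 - cfc (ramp 0 δ) s)
  refine (CStarAlgebra.norm_le_norm_of_nonneg_of_le
    (star_right_conjugate_nonneg hx _) h1).trans ?_
  rw [one_sub_cfc hssa hrc, (isSelfAdjoint_cfc _).star_eq]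
  nth_rewrite 2 [← cfc_id' ℝ s]
  rw [← cfc_mul _ _ s (by fun_prop) (by fun_prop), ← cfc_mul _ _ s (by fun_prop) (by fun_prop)]
  refine norm_cfc_le hδ.le fun z hz => ?_
  have hz0 := spectrum_nonneg_of_nonneg hs hz
  have h2 := ramp_nonneg hδ z
  have h3 : ramp 0 δ z ≤ 1 := min_le_left _ _
  rw [Real.norm_of_nonneg (by have : 0 ≤ 1 - ramp 0 δ z := by linarith
                              positivity)]
  rcases le_total z δ with h | h
  · have h4 : (1 - ramp 0 δ z) * z ≤ z := mul_le_of_le_one_left hz0 (by linarith)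
    have h5 : (1 - ramp 0 δ z) * z * (1 - ramp 0 δ z) ≤ (1 - ramp 0 δ z) * z :=
      mul_le_of_le_one_right (mul_nonneg (by linarith) hz0) (by linarith)
    linarith
  · rw [ramp_eq_one hδ h]; simp [hδ.le]

/-- A positive contraction in the bounded sequences of `A` which is a unit, modulo null sequences,
for everything below `s`. -/
lemma exists_seq_unit [PartialOrder M] [StarOrderedRing M] (ι : A →⋆ₙₐ[ℂ] M) {s : A} (hs : 0 ≤ s) :
    ∃ e : BddSeq M, 0 ≤ e ∧ e ≤ 1 ∧ (∀ n, ∃ a, ι a = eval n e) ∧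
      ∀ a : A, 0 ≤ a → a ≤ s → toQuotient M (e * const (ι a)) = toQuotient M (const (ι a)) := by
  have hπ : CStarKernel (toQuotient M) := cstarKernel
  have hδ : ∀ n : ℕ, 0 < 1 / ((n : ℝ) + 1) := fun n => Nat.one_div_pos_of_nat
  -- The unit is built as `R⋆R` from the square roots, so that positivity in the sequence algebra is
  -- immediate.
  set r : ℕ → M := fun n => cfc (fun z => √(ramp 0 (1 / ((n : ℝ) + 1)) z)) (ι s) with hr
  have hcr : ∀ n : ℕ, Continuous fun z => √(ramp 0 (1 / ((n : ℝ) + 1)) z) := fun n =>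
    (continuous_ramp _ _).sqrt
  have hrle : ∀ n, ‖r n‖ ≤ 1 := fun n => norm_cfc_le zero_le_one fun z _ => by
    rw [Real.norm_of_nonneg (Real.sqrt_nonneg _)]
    exact Real.sqrt_le_one.mpr (min_le_left _ _)
  have hrr : ∀ n, star (r n) * r n = cfc (ramp 0 (1 / ((n : ℝ) + 1))) (ι s) := fun n => by
    rw [(isSelfAdjoint_cfc _ : IsSelfAdjoint (r n)).star_eq]
    refine (cfc_eq_mul (hcr n) (hcr n) fun z _ => ?_).symm
    rw [Real.mul_self_sqrt (ramp_nonneg (hδ n) z)]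
  set R : BddSeq M := BddSeq.mk r 1 hrle with hR
  have he : ∀ n, eval n (star R * R) = cfc (ramp 0 (1 / ((n : ℝ) + 1))) (ι s) := fun n => by
    rw [map_mul, map_star, hR, eval_mk, hrr]
  have he0 : 0 ≤ star R * R := star_mul_self_nonneg R
  have hRle : ‖R‖ ≤ 1 := norm_le zero_le_one hrle
  refine ⟨star R * R, he0, ?_, fun n => ?_, fun a ha has => ?_⟩
  · refine (CStarAlgebra.norm_le_one_iff_of_nonneg _ he0).mp ?_
    rw [CStarRing.norm_star_mul_self]
    exact mul_le_one₀ hRle (norm_nonneg _) hRle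
  · exact ⟨cfcₙ (ramp 0 (1 / ((n : ℝ) + 1))) s, by
      rw [he, map_cfcₙ (.of_nonneg hs) (continuous_ramp _ _) (ramp_eq_zero le_rfl)]⟩
  · obtain ⟨c, hcsa, hcc⟩ := exists_isSelfAdjoint_mul_self (const_map_nonneg ι ha)
    have h1 : toQuotient M ((1 - star R * R) * c) = 0 := by
      refine hπ.mul_eq_zero_of_sq ?_
      rw [hcsa.star_eq, hcc, toQuotient_eq_zero]
      refine squeeze_zero (fun _ => norm_nonneg _) (fun n => ?_)
        (tendsto_one_div_add_atTop_nhds_zero_nat (𝕜 := ℝ))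
      rw [map_mul, map_mul, map_star, map_sub, map_one, he, eval_const]
      refine norm_one_sub_ramp_mul_mul_le (map_nonneg' ι ha) ?_ (hδ n)
      rw [← sub_nonneg, ← map_sub]
      exact map_nonneg' ι (sub_nonneg.mpr has)
    have h2 : toQuotient M ((1 - star R * R) * const (ι a)) = 0 := by
      rw [← hcc, ← mul_assoc, map_mul, h1, zero_mul]
    rw [sub_mul, one_mul, map_sub, sub_eq_zero] at h2
    exact h2.symm

theorem exists_close_conj [PartialOrder M] [StarOrderedRing M] (hι : FlipEmbedding ι) {a b : A}
    {r₀ r : ℝ} (ha : 0 ≤ a) (hb : 0 ≤ b) (hr₀ : 0 ≤ r₀) (hr : r₀ < r)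
    (hab : CutDownLE (toQuotient M) r₀ (const (ι a)) (const (ι b)))
    (hba : CutDownLE (toQuotient M) r₀ (const (ι b)) (const (ι a))) {ε : ℝ} (hε : 0 < ε) :
    ∃ b' : A, 0 ≤ b' ∧ ‖a - b'‖ < 4 * r ∧
      ∃ u ∈ unitary M, ‖u * ι b * star u - ι b'‖ < ε := by
  have hπ : CStarKernel (toQuotient M) := cstarKernel
  obtain ⟨e, he0, he1, heA, he⟩ := exists_seq_unit ι (add_nonneg ha hb)
  have hesa : IsSelfAdjoint e := .of_nonneg he0
  have hea := he a ha (le_add_of_nonneg_right hb)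
  have heb := he b hb (le_add_of_nonneg_left ha)
  have ha' := const_map_nonneg ι ha
  have hb' := const_map_nonneg ι hb
  -- With `η = (r - r₀) / 8` one has `r₀ + 2η < g`, while `4g + 2 (r - r₀) = 4r` leaves room for two
  -- errors below `r - r₀`: the kernel terms in the order inequalities and the compression by `e`.
  set g := (r₀ + r) / 2 with hg
  obtain ⟨u, hu, w, hw, hue, hwe, hint⟩ := exists_interlaced hπ (g := g) (η := (r - r₀) / 8) ha' hb'
    he0 he1 (hι.hasFlips heA he0) hea heb hr₀ (by linarith) (by rw [hg]; linarith) hab hba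
  have hx := star_right_conjugate_nonneg ha' u
  have hz := star_right_conjugate_nonneg hb' w
  set X := u * const (ι a) * star u with hX
  set Z := w * const (ι b) * star w with hZ
  have hle : (∃ j, toQuotient M j = 0 ∧ X ≤ Z + algebraMap ℝ (BddSeq M) (4 * g) + j) ∧
      ∃ j, toQuotient M j = 0 ∧ Z ≤ X + algebraMap ℝ (BddSeq M) (4 * g) + j := by
    rcases hint with h | h
    · exact h.exists_le_add hπ hx hz (by linarith) (by rw [hg]; linarith)
    · exact (h.exists_le_add hπ hz hx (by linarith) (by rw [hg]; linarith)).symm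
  obtain ⟨⟨j, hj, hjle⟩, k, hk, hkle⟩ := hle
  -- Undoing `u` keeps `a` fixed and moves only `b`. As `v` commutes with `e` modulo null sequences,
  -- `e` is still a unit for the conjugate of `b`.
  set v := star u * w with hv
  have hvmem : v ∈ unitary (BddSeq M) := mul_mem (Unitary.star_mem hu) hw
  have hve : toQuotient M (v * e) = toQuotient M (e * v) := by
    have h1 := CStarKernel.commute_star hu hue
    simp only [hv, map_mul] at h1 hwe ⊢
    rw [mul_assoc, hwe, ← mul_assoc, h1, mul_assoc]
  have heB := conj_mem_unit hve heb
  set B' := v * const (ι b) * star v with hB'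
  have hB'sa : IsSelfAdjoint B' := isSelfAdjoint_conj (.of_nonneg hb') v
  have heBe : toQuotient M (e * B' * e) = toQuotient M B' := by
    have h2 := hπ.star_eq heB
    rw [star_mul, hesa.star_eq, hB'sa.star_eq] at h2
    rw [map_mul, heB, ← map_mul, h2]
  rw [toQuotient_eq_zero] at hj hk
  rw [toQuotient_eq] at heBe
  have hrr : 0 < r - r₀ := by linarith
  obtain ⟨n, ⟨hjn, hkn⟩, hen1, hen2⟩ := ((hj.eventually_lt_const hrr).and
    (hk.eventually_lt_const hrr)).and ((heBe.eventually_lt_const hrr).and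
      (heBe.eventually_lt_const hε)) |>.exists
  have halg : ∀ c : ℝ, eval n (algebraMap ℝ (BddSeq M) c) = algebraMap ℝ M c := fun c => by
    rw [Algebra.algebraMap_eq_smul_one, Algebra.algebraMap_eq_smul_one, ← Complex.coe_smul,
      map_smul, map_one, Complex.coe_smul]
  have hXZ : ‖eval n X - eval n Z‖ ≤ 4 * g + (r - r₀) := by
    have h1 := eval_mono hjle n
    have h2 := eval_mono hkle n
    rw [map_add, map_add, halg] at h1 h2
    exact norm_sub_le_of_le_add (by rw [hg]; linarith) h1 h2 hjn.le hkn.le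
      ((IsSelfAdjoint.of_nonneg hx).map (eval n)) ((IsSelfAdjoint.of_nonneg hz).map (eval n))
  obtain ⟨f, hf⟩ := heA n
  obtain ⟨c, hc⟩ := CStarAlgebra.nonneg_iff_eq_star_mul_self.mp hb
  -- With `b = c⋆c` and `f` mapping to the `n`-th term of `e`, the element `d⋆d` of `A` maps to the
  -- `n`-th term of `e v b v⋆ e`; this form shows that it is positive.
  obtain ⟨d, hd⟩ := hι.hereditary c f (star (eval n v))
  have hd' : ι (star d * d) = eval n (e * B' * e) := by
    have hesa' : star (eval n e) = eval n e := by rw [← map_star, hesa.star_eq]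
    have hb'' : star (ι c) * ι c = ι b := by rw [hc, map_mul, map_star]
    rw [map_mul, map_star, hd, hf, hB']
    simp only [star_mul, star_star, hesa', map_mul, map_star, eval_const, ← hb'', mul_assoc]
  have hun := eval_mem_unitary hu n
  have hB'n : ‖ι a - eval n B'‖ = ‖eval n X - eval n Z‖ := by
    have h1 : ι a - eval n B' = star (eval n u) * (eval n X - eval n Z) * eval n u := by
      have h2 := (Unitary.mem_iff.mp hun).1
      have h3 : star (eval n u) * eval n X * eval n u = ι a := by
        rw [hX, map_mul, map_mul, map_star, eval_const,
          show star (eval n u) * (eval n u * ι a * star (eval n u)) * eval n u =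
            (star (eval n u) * eval n u) * ι a * (star (eval n u) * eval n u) by
          simp only [mul_assoc], h2, one_mul, mul_one]
      rw [mul_sub, sub_mul, h3, hB', hZ, hv]
      simp only [star_mul, star_star, map_mul, map_star, mul_assoc]
    rw [h1, CStarRing.norm_mul_mem_unitary _ hun,
      CStarRing.norm_mem_unitary_mul _ (Unitary.star_mem hun)]
  refine ⟨star d * d, star_mul_self_nonneg d, ?_, eval n v, eval_mem_unitary hvmem n, ?_⟩
  · rw [← hι.norm_map, map_sub, hd']
    have h1 := norm_sub_le_norm_sub_add_norm_sub (ι a) (eval n B') (eval n (e * B' * e))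
    rw [norm_sub_rev (eval n B')] at h1
    rw [hB'n] at h1
    have h2 : 4 * g = 2 * (r₀ + r) := by rw [hg]; ring
    linarith
  · rw [hd', norm_sub_rev]
    simpa only [hB', map_mul, map_star, eval_const] using hen2

end FlipEmbedding

/-! ### The corner embedding is hereditary. -/

section Corner

variable {A : Type u} [NonUnitalCStarAlgebra A]

namespace Stabilization

open UniformSpace

lemma entry_cornerMatrix (a : A) (i j : ℕ) :
    (cornerMatrix a).entry i j = if i = 0 ∧ j = 0 then a else 0 := rfl

lemma supportedIn_cornerMatrix (a : A) :
    (cornerMatrix a).SupportedIn 1 := fun i j h => by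
  rw [entry_cornerMatrix]; exact if_neg (by omega)

lemma cornerMatrix_mul (a b : A) : cornerMatrix (a * b) = cornerMatrix a * cornerMatrix b := by
  refine FinMatrix.ext fun i j => ?_
  rw [FinMatrix.entry_mul _ _ (supportedIn_cornerMatrix a)]
  by_cases hi : i = 0 <;> by_cases hj : j = 0 <;> simp [entry_cornerMatrix, hi, hj]

lemma cornerMatrix_mul_mul (a b : A) (x : FinMatrix A) :
    cornerMatrix a * x * cornerMatrix b = cornerMatrix (a * x.entry 0 0 * b) := by
  have h1 : ∀ i j, (cornerMatrix a * x).entry i j = if i = 0 then a * x.entry 0 j else 0 := by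
    intro i j
    rw [FinMatrix.entry_mul _ _ (supportedIn_cornerMatrix a)]
    by_cases hi : i = 0 <;> simp [entry_cornerMatrix, hi]
  obtain ⟨n, hn⟩ := (cornerMatrix a * x).exists_supportedIn
  refine FinMatrix.ext fun i j => ?_
  -- The enlarged range `n + 1` is nonempty, so the term with index 0, the only one that can be
  -- nonzero, splits off.
  rw [FinMatrix.entry_mul _ _ (hn.mono (Nat.le_succ n)), Finset.sum_range_succ']
  by_cases hi : i = 0 <;> by_cases hj : j = 0 <;> simp [entry_cornerMatrix, h1, hi, hj]

/-- The corner embedding as a ⋆-homomorphism. -/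
noncomputable def cornerHom (A : Type u) [NonUnitalCStarAlgebra A] [PartialOrder A]
    [StarOrderedRing A] : A →⋆ₙₐ[ℂ] Stabilization A where
  toFun := corner
  map_smul' c a := by
    change ((cornerMatrix (c • a) : FinMatrix A) : Stabilization A) = c • ((cornerMatrix a : FinMatrix A) : Stabilization A)
    rw [← Completion.coe_smul]
    congr 1
    exact FinMatrix.ext fun i j => by simp [entry_cornerMatrix]
  map_zero' := by
    change ((cornerMatrix 0 : FinMatrix A) : Stabilization A) = 0
    rw [← Completion.coe_zero]
    congr 1
    exact FinMatrix.ext fun i j => by simp [entry_cornerMatrix]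
  map_add' a b := by
    change ((cornerMatrix (a + b) : FinMatrix A) : Stabilization A) =
      ((cornerMatrix a : FinMatrix A) : Stabilization A) + ((cornerMatrix b : FinMatrix A) : Stabilization A)
    rw [← Completion.coe_add]
    congr 1
    refine FinMatrix.ext fun i j => ?_
    by_cases h : i = 0 ∧ j = 0 <;> simp [entry_cornerMatrix, h]
  map_mul' a b := by
    change ((cornerMatrix (a * b) : FinMatrix A) : Stabilization A) =
      ((cornerMatrix a : FinMatrix A) : Stabilization A) * ((cornerMatrix b : FinMatrix A) : Stabilization A)
    rw [← coe_mul, cornerMatrix_mul]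
  map_star' a := by
    change ((cornerMatrix (star a) : FinMatrix A) : Stabilization A) =
      star ((cornerMatrix a : FinMatrix A) : Stabilization A)
    rw [← coe_star]
    congr 1
    refine FinMatrix.ext fun i j => ?_
    rw [FinMatrix.entry_star]
    by_cases hi : i = 0 <;> by_cases hj : j = 0 <;> simp [entry_cornerMatrix, hi, hj]

end Stabilization

variable [PartialOrder A] [StarOrderedRing A]

namespace Stabilization

open UniformSpace

lemma cornerHom_injective : Function.Injective (cornerHom A) := by
  intro a b h
  have h1 : cornerMatrix a = cornerMatrix b := Completion.coe_injective _ h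
  have := congrArg (fun x => FinMatrix.entry x 0 0) h1
  simpa [entry_cornerMatrix] using this

/-- On finitely supported matrices only the entry at `(0, 0)` contributes. The general case follows
by density, the range of the isometric embedding being closed. -/
lemma exists_cornerHom_eq (a b : A) (s : Stabilization A) :
    ∃ c, cornerHom A c = cornerHom A a * s * cornerHom A b := by
  have hclosed : IsClosed (Set.range (cornerHom A)) :=
    (NonUnitalStarAlgHom.isometry (cornerHom A) cornerHom_injective).isClosedEmbedding.isClosed_range
  change cornerHom A a * s * cornerHom A b ∈ Set.range (cornerHom A)
  refine Completion.induction_on s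
    (hclosed.preimage (by fun_prop : Continuous fun s => cornerHom A a * s * cornerHom A b))
    fun x => ⟨a * x.entry 0 0 * b, ?_⟩
  change ((cornerMatrix (a * x.entry 0 0 * b) : FinMatrix A) : Stabilization A) =
    ((cornerMatrix a : FinMatrix A) : Stabilization A) * x *
      ((cornerMatrix b : FinMatrix A) : Stabilization A)
  rw [← coe_mul, ← coe_mul, cornerMatrix_mul_mul]

end Stabilization

/-- The embedding of `A` in `(A ⊗ K)~` as a ⋆-homomorphism. -/
noncomputable def stableHom (A : Type u) [NonUnitalCStarAlgebra A] [PartialOrder A]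
    [StarOrderedRing A] : A →⋆ₙₐ[ℂ] Unitization ℂ (Stabilization A) :=
  (Unitization.inrNonUnitalStarAlgHom ℂ (Stabilization A)).comp (Stabilization.cornerHom A)

lemma stableHom_apply (a : A) : stableHom A a = toStable a := rfl

lemma flipEmbedding_stableHom (hA : PropertyI A) : FlipEmbedding (stableHom A) where
  injective := Unitization.inr_injective.comp Stabilization.cornerHom_injective
  hereditary a b m := by
    induction m using Unitization.ind with
    | inl_add_inr l s =>
      obtain ⟨c, hc⟩ := Stabilization.exists_cornerHom_eq a b s
      refine ⟨l • (a * b) + c, ?_⟩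
      have h1 : ((Stabilization.cornerHom A c : Stabilization A) :
          Unitization ℂ (Stabilization A)) = stableHom A a * s * stableHom A b := by
        rw [hc, Unitization.inr_mul, Unitization.inr_mul]; rfl
      have h2 : stableHom A c = stableHom A a * s * stableHom A b := h1
      rw [map_add, map_smul, map_mul, h2, mul_add, add_mul]
      congr 1
      rw [← Unitization.algebraMap_eq_inl, Algebra.algebraMap_eq_smul_one, mul_smul_comm, mul_one,
        smul_mul_assoc]
  flip x e he0 he1 hex hxe ε hε := by
    obtain ⟨u, hu⟩ := hA x e he0 he1 hex hxe
    obtain ⟨N, hN⟩ := Metric.tendsto_atTop.mp hu ε hε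
    refine ⟨u N, (u N).2, ?_⟩
    have := hN N le_rfl
    rwa [dist_eq_norm] at this

end Corner

/-! ### Comparison of cut-downs, from Cuntz comparison and from norm estimates. -/

section CutDown

open BddSeq

variable {M : Type*} [CStarAlgebra M]

lemma exists_bddSeq_of_tendsto {a b : M} {s t : ℝ} (ha : IsSelfAdjoint a) (hb : IsSelfAdjoint b)
    {y : ℕ → M} (hy : Tendsto (fun n => star (y n) * y n) atTop (𝓝 (cfc (fun z : ℝ => max (z - t) 0) b)))
    (hya : ∀ n, cfc (fun z : ℝ => max (s - z) 0) a * y n = 0) :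
    ∃ y : BddSeq M, toQuotient M (star y * y) =
      toQuotient M (cfc (fun z : ℝ => max (z - t) 0) (const b)) ∧
      toQuotient M (cfc (fun z : ℝ => max (s - z) 0) (const a) * y) = 0 := by
  have hca : IsSelfAdjoint (const a) := isSelfAdjoint_of_eval fun _ => ha
  have hcb : IsSelfAdjoint (const b) := isSelfAdjoint_of_eval fun _ => hb
  obtain ⟨C, hC⟩ := hy.norm.bddAbove_range
  have hbd : ∀ n, ‖y n‖ ≤ √C := fun n => Real.le_sqrt_of_sq_le (by
    have : ‖star (y n) * y n‖ ≤ C := hC ⟨n, rfl⟩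
    rw [CStarRing.norm_star_mul_self] at this
    rwa [sq])
  refine ⟨BddSeq.mk y (√C) hbd, ?_, ?_⟩
  · rw [toQuotient_eq]
    have h1 := (tendsto_iff_norm_sub_tendsto_zero.mp hy)
    refine h1.congr fun n => ?_
    rw [eval_cfc hcb (by fun_prop), map_mul, map_star, eval_const, eval_mk]
  · have h1 : cfc (fun z : ℝ => max (s - z) 0) (const a) * BddSeq.mk y (√C) hbd = 0 :=
      BddSeq.ext fun n => by
        rw [map_mul, eval_cfc hca (by fun_prop), eval_const, eval_mk, hya, map_zero]
    rw [h1, map_zero]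

variable {A : Type*} [NonUnitalCStarAlgebra A]

lemma map_cutDown (ι : A →⋆ₙₐ[ℂ] M) {a : A} (ha : IsSelfAdjoint a) {t : ℝ} (ht : 0 ≤ t) :
    ι (cutDown t a) = cfc (fun z : ℝ => max (z - t) 0) (ι a) :=
  FlipEmbedding.map_cfcₙ ha (by fun_prop) (by simp [ht])

lemma cutDownLE_of_cuntzLE (ι : A →⋆ₙₐ[ℂ] M) {a b : A} (ha : IsSelfAdjoint a)
    (hb : IsSelfAdjoint b) {r : ℝ} (hr : 0 ≤ r)
    (h : ∀ t : ℝ, 0 ≤ t → CuntzLE (cutDown (t + r) b) (cutDown t a)) :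
    CutDownLE (toQuotient M) r (const (ι b)) (const (ι a)) := by
  intro s t hs hst
  -- The witness is `(a - (t - r))₊^(1/2) dₙ`. It is annihilated exactly by `(s - a)₊` because `s <
  -- t - r`.
  obtain ⟨d, hd⟩ := h (t - r) (by linarith)
  rw [sub_add_cancel] at hd
  have hc : Continuous ι := map_continuous ι
  have hd' := (hc.tendsto _).comp hd
  rw [map_cutDown ι hb (by linarith)] at hd'
  have hsq : cfc (fun z : ℝ => √(max (z - (t - r)) 0)) (ι a) *
      cfc (fun z : ℝ => √(max (z - (t - r)) 0)) (ι a) =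
        cfc (fun z : ℝ => max (z - (t - r)) 0) (ι a) := by
    refine (cfc_eq_mul (by fun_prop) (by fun_prop) fun z _ => ?_).symm
    rw [Real.mul_self_sqrt (le_max_right _ _)]
  refine exists_bddSeq_of_tendsto (ha.map ι) (hb.map ι)
    (y := fun n => cfc (fun z : ℝ => √(max (z - (t - r)) 0)) (ι a) * ι (d n)) ?_ fun n => ?_
  · refine hd'.congr fun n => ?_
    simp only [Function.comp_apply, map_mul, map_star]
    rw [map_cutDown ι ha (by linarith), star_mul, (isSelfAdjoint_cfc _).star_eq, ← hsq]
    simp only [mul_assoc]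
  · rw [← mul_assoc, cfc_mul_eq_zero (by fun_prop) (by fun_prop), zero_mul]
    intro z _
    rcases le_total z s with h | h
    · rw [max_eq_right (by linarith : z - (t - r) ≤ 0)]; simp
    · rw [max_eq_right (by linarith : s - z ≤ 0)]; simp

variable [PartialOrder M] [StarOrderedRing M]

/-- An element below `c` is Cuntz smaller than `c`. -/
lemma exists_tendsto_of_le {x c : M} (hx : 0 ≤ x) (hxc : x ≤ c) :
    ∃ d : ℕ → M, Tendsto (fun n => star (d n) * c * d n) atTop (𝓝 x) := by
  have hc0 : 0 ≤ c := hx.trans hxc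
  have hcsa : IsSelfAdjoint c := .of_nonneg hc0
  obtain ⟨q, hq, hqq⟩ := exists_isSelfAdjoint_mul_self hx
  have hδ : ∀ n : ℕ, 0 < 1 / ((n : ℝ) + 1) := fun n => Nat.one_div_pos_of_nat
  have hpos : ∀ (n : ℕ) (z : ℝ), 0 < max z 0 + 1 / ((n : ℝ) + 1) := fun n z =>
    add_pos_of_nonneg_of_pos (le_max_right _ _) (hδ n)
  -- Write `δ = 1 / (n + 1)`, so that `F = (c + δ)^(-1/2)`, and take `d = F q` with `q² = x`. Then
  -- `FcF = 1 - δF²`, so the error is `-δ qF²q`, and `‖qF²q‖ = ‖FxF‖ ≤ ‖FcF‖ ≤ 1`.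
  set F : ℕ → M := fun n => cfc (fun z : ℝ => 1 / √(max z 0 + 1 / ((n : ℝ) + 1))) c with hF
  have hcont : ∀ n : ℕ, Continuous fun z : ℝ => 1 / √(max z 0 + 1 / ((n : ℝ) + 1)) := fun n =>
    continuous_const.div (by fun_prop) fun z => (Real.sqrt_pos.mpr (hpos n z)).ne'
  have hFsa : ∀ n, IsSelfAdjoint (F n) := fun n => isSelfAdjoint_cfc _
  have hFcF : ∀ n, F n * c * F n = cfc (fun z : ℝ => 1 / √(max z 0 + 1 / ((n : ℝ) + 1)) * z *
      (1 / √(max z 0 + 1 / ((n : ℝ) + 1)))) c := fun n => by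
    have h1 := hcont n
    have h2 : Continuous fun z : ℝ => 1 / √(max z 0 + 1 / ((n : ℝ) + 1)) * z :=
      h1.mul continuous_id
    rw [cfc_mul _ _ c h2.continuousOn h1.continuousOn, cfc_mul _ _ c h1.continuousOn (by fun_prop),
      cfc_id' ℝ c]
  have hval : ∀ (n : ℕ) (z : ℝ), 0 ≤ z → 1 / √(max z 0 + 1 / ((n : ℝ) + 1)) * z *
      (1 / √(max z 0 + 1 / ((n : ℝ) + 1))) = z / (z + 1 / ((n : ℝ) + 1)) := fun n z hz => by
    have h1 := Real.mul_self_sqrt (hpos n z).le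
    rw [mul_right_comm, div_mul_div_comm, h1, max_eq_left hz]
    ring
  have hFcFle : ∀ n, ‖F n * c * F n‖ ≤ 1 := fun n => by
    rw [hFcF]
    refine norm_cfc_le zero_le_one fun z hz => ?_
    have hz0 := spectrum_nonneg_of_nonneg hc0 hz
    have := hδ n
    rw [hval n z hz0, Real.norm_of_nonneg (by positivity), div_le_one (by positivity)]
    linarith
  have hid : ∀ n : ℕ, F n * c * F n = 1 - (1 / ((n : ℝ) + 1)) • (F n * F n) := fun n => by
    have h1 := hcont n
    have h2 : Continuous fun z : ℝ => 1 / √(max z 0 + 1 / ((n : ℝ) + 1)) *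
      (1 / √(max z 0 + 1 / ((n : ℝ) + 1))) := h1.mul h1
    have h4 : Continuous fun z : ℝ => (1 / ((n : ℝ) + 1)) •
      (1 / √(max z 0 + 1 / ((n : ℝ) + 1)) * (1 / √(max z 0 + 1 / ((n : ℝ) + 1)))) :=
      continuous_const.mul h2
    rw [hFcF, hF, ← cfc_mul _ _ c h1.continuousOn h1.continuousOn, ← cfc_smul _ _ c h2.continuousOn,
      one_sub_cfc hcsa h4]
    refine cfc_congr fun z hz => ?_
    have hz0 := spectrum_nonneg_of_nonneg hc0 hz
    have h3 := hpos n z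
    rw [max_eq_left hz0] at h3
    rw [hval n z hz0, div_mul_div_comm, Real.mul_self_sqrt (hpos n z).le, max_eq_left hz0,
      smul_eq_mul]
    field_simp
    ring
  refine ⟨fun n => F n * q, tendsto_iff_norm_sub_tendsto_zero.mpr ?_⟩
  refine squeeze_zero (fun _ => norm_nonneg _) (fun n => ?_)
    (tendsto_one_div_add_atTop_nhds_zero_nat (𝕜 := ℝ))
  have e1 : star (F n * q) * c * (F n * q) - x =
      -((1 / ((n : ℝ) + 1)) • (star (F n * q) * (F n * q))) := by
    rw [star_mul, hq.star_eq, (hFsa n).star_eq,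
      show q * F n * c * (F n * q) = q * (F n * c * F n) * q by simp only [mul_assoc], hid, ← hqq,
      mul_sub, sub_mul, mul_one, mul_smul_comm, smul_mul_assoc]
    simp only [mul_assoc]
    abel
  have e2 : ‖star (F n * q) * (F n * q)‖ ≤ 1 := by
    rw [CStarRing.norm_star_mul_self, ← CStarRing.norm_self_mul_star, star_mul, hq.star_eq,
      (hFsa n).star_eq, show F n * q * (q * F n) = F n * (q * q) * F n by simp only [mul_assoc], hqq]
    refine le_trans ?_ (hFcFle n)
    have h1 := star_right_conjugate_le_conjugate hxc (F n)
    have h2 := star_right_conjugate_nonneg hx (F n)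
    rw [(hFsa n).star_eq] at h1 h2
    exact CStarAlgebra.norm_le_norm_of_nonneg_of_le h2 h1
  rw [e1, norm_neg, norm_smul, Real.norm_of_nonneg (hδ n).le]
  exact mul_le_of_le_one_right (hδ n).le e2

/-- The norm bound gives `b - (s + r) ≤ u (a - s)₊ u⋆`. Multiplying both sides by a function of `b`
supported on `[t, ∞)` turns the left side into `(b - t)₊`, and an element below another is Cuntz
smaller. The witnesses lie in `M` and need not come from `A`. -/
lemma cutDownLE_of_norm_conj_sub_le {a b u : M} (ha : IsSelfAdjoint a) (hb : IsSelfAdjoint b)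
    (hu : u ∈ unitary M) {r : ℝ} (h : ‖u * a * star u - b‖ ≤ r) :
    CutDownLE (toQuotient M) r (const b) (const a) := by
  intro s t hs hst
  have hpos : ∀ z : ℝ, 0 < max (z - (s + r)) (t - (s + r)) := fun z =>
    lt_of_lt_of_le (by linarith) (le_max_right _ _)
  set g : ℝ → ℝ := fun z => √(max (z - t) 0 / max (z - (s + r)) (t - (s + r))) with hg
  have hgc : Continuous g :=
    (Continuous.div (by fun_prop) (by fun_prop) fun z => (hpos z).ne').sqrt
  set G := cfc g b with hG
  have hGsa : IsSelfAdjoint G := isSelfAdjoint_cfc _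
  set c := u * cfc (fun z : ℝ => max (z - s) 0) a * star u with hc
  have hasub : u * a * star u - algebraMap ℝ M s ≤ c := by
    have h1 : a - algebraMap ℝ M s ≤ cfc (fun z : ℝ => max (z - s) 0) a := by
      have h2 : a - algebraMap ℝ M s = cfc (fun z : ℝ => z - s) a := by
        rw [cfc_sub _ _ a (by fun_prop) (by fun_prop), cfc_id' ℝ a, cfc_const s a]
      rw [h2]
      exact cfc_mono fun z _ => le_max_left _ _
    have h3 := star_right_conjugate_le_conjugate h1 u
    refine le_trans (le_of_eq ?_) h3
    rw [mul_sub, sub_mul, ← Algebra.commutes, mul_assoc (algebraMap ℝ M s),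
      (Unitary.mem_iff.mp hu).2, mul_one]
  have hbc : b - algebraMap ℝ M (s + r) ≤ c := by
    have hsa : IsSelfAdjoint (b - u * a * star u) := hb.sub (isSelfAdjoint_conj ha u)
    have h1 : b - u * a * star u ≤ algebraMap ℝ M r :=
      hsa.le_algebraMap_norm_self.trans (algebraMap_mono M (by rwa [norm_sub_rev]))
    have h2 := add_le_add h1 hasub
    refine le_trans (le_of_eq ?_) (sub_le_iff_le_add'.mpr h2)
    rw [map_add]; abel
  have hGb : G * (b - algebraMap ℝ M (s + r)) * G = cfc (fun z : ℝ => max (z - t) 0) b := by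
    have h2 : b - algebraMap ℝ M (s + r) = cfc (fun z : ℝ => z - (s + r)) b := by
      rw [cfc_sub _ _ b (by fun_prop) (by fun_prop), cfc_id' ℝ b, cfc_const (s + r) b]
    have h3 : Continuous fun z : ℝ => g z * (z - (s + r)) := by fun_prop
    rw [h2, hG, ← cfc_mul _ _ b hgc.continuousOn (by fun_prop),
      ← cfc_mul _ _ b h3.continuousOn hgc.continuousOn]
    refine cfc_congr fun z _ => ?_
    have h4 : g z * g z = max (z - t) 0 / max (z - (s + r)) (t - (s + r)) :=
      Real.mul_self_sqrt (div_nonneg (le_max_right _ _) (hpos z).le)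
    rw [mul_right_comm, h4]
    rcases le_total z t with h5 | h5
    · rw [max_eq_right (by linarith : z - t ≤ 0)]; simp
    · rw [max_eq_left (by linarith : t - (s + r) ≤ z - (s + r)), div_mul_cancel₀]
      exact (by linarith : 0 < z - (s + r)).ne'
  have hle : cfc (fun z : ℝ => max (z - t) 0) b ≤ G * c * G := by
    rw [← hGb]
    simpa only [hGsa.star_eq] using star_right_conjugate_le_conjugate hbc G
  obtain ⟨d, hd⟩ := exists_tendsto_of_le (cfc_max_sub_nonneg b t) hle
  have hsq : cfc (fun z : ℝ => √(max (z - s) 0)) a * cfc (fun z : ℝ => √(max (z - s) 0)) a =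
      cfc (fun z : ℝ => max (z - s) 0) a := by
    refine (cfc_eq_mul (by fun_prop) (by fun_prop) fun z _ => ?_).symm
    rw [Real.mul_self_sqrt (le_max_right _ _)]
  refine exists_bddSeq_of_tendsto ha hb
    (y := fun n => cfc (fun z : ℝ => √(max (z - s) 0)) a * (star u * G * d n)) ?_ fun n => ?_
  · refine hd.congr fun n => ?_
    rw [hc, ← hsq]
    simp only [star_mul, star_star, hGsa.star_eq, (isSelfAdjoint_cfc _).star_eq, mul_assoc]
  · rw [← mul_assoc, cfc_mul_eq_zero (by fun_prop) (by fun_prop), zero_mul]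
    intro z _
    rcases le_total z s with h | h
    · rw [max_eq_right (by linarith : z - s ≤ 0)]; simp
    · rw [max_eq_right (by linarith : s - z ≤ 0)]; simp

end CutDown

open BddSeq

/-! ### The two assertions for the stable unitary orbits. -/

section Stable

variable {A : Type u} [NonUnitalCStarAlgebra A] [PartialOrder A] [StarOrderedRing A]

lemma exists_close_of_cutDownLE (hA : PropertyI A) {a b : A} (ha : 0 ≤ a) (hb : 0 ≤ b) {r₀ r : ℝ}
    (hr₀ : 0 ≤ r₀) (hr : r₀ < r)
    (hab : CutDownLE (toQuotient _) r₀ (const (stableHom A a)) (const (stableHom A b)))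
    (hba : CutDownLE (toQuotient _) r₀ (const (stableHom A b)) (const (stableHom A a)))
    {ε : ℝ} (hε : 0 < ε) : ∃ b' : A, 0 ≤ b' ∧ ‖a - b'‖ < 4 * r ∧ dU b b' < ε := by
  let _ := CStarAlgebra.spectralOrder (Unitization ℂ (Stabilization A))
  have := CStarAlgebra.spectralOrderedRing (Unitization ℂ (Stabilization A))
  obtain ⟨b', hb', h1, u, hu, h2⟩ :=
    (flipEmbedding_stableHom hA).exists_close_conj ha hb hr₀ hr hab hba hε
  exact ⟨b', hb', h1, (dU_le ⟨⟨u, hu⟩, rfl⟩ (toStable_mem_stableOrbit b')).trans_lt h2⟩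

lemma cutDown_eq_zero {a : A} (ha : 0 ≤ a) {t : ℝ} (ht : ‖a‖ ≤ t) : cutDown t a = 0 := by
  unfold cutDown
  rw [cfcₙ_congr (g := fun _ => 0) fun x hx => ?_, cfcₙ_const_zero]
  have h1 : ‖x‖ ≤ ‖a‖ := NonUnitalIsometricContinuousFunctionalCalculus.norm_quasispectrum_le a hx (.of_nonneg ha)
  exact max_eq_right (by linarith [(le_abs_self x).trans h1])

lemma exists_cuntzLE_of_dW_lt {a b : A} (ha : 0 ≤ a) (hb : 0 ≤ b) {r : ℝ} (h : dW a b < r) :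
    ∃ s, 0 ≤ s ∧ s < r ∧ ∀ t : ℝ, 0 ≤ t →
      CuntzLE (cutDown (t + s) a) (cutDown t b) ∧ CuntzLE (cutDown (t + s) b) (cutDown t a) := by
  have hz : ∀ c : A, CuntzLE 0 c := fun c => ⟨fun _ => 0, by simp⟩
  -- The set is nonempty: at `‖a‖ + ‖b‖` both cut-downs vanish, and zero is Cuntz smaller than
  -- anything.
  obtain ⟨s, ⟨hs0, hs⟩, hsr⟩ := exists_lt_of_csInf_lt (s := {r : ℝ | 0 ≤ r ∧ ∀ t : ℝ, 0 ≤ t →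
    CuntzLE (cutDown (t + r) a) (cutDown t b) ∧ CuntzLE (cutDown (t + r) b) (cutDown t a)})
    ⟨‖a‖ + ‖b‖, by positivity, fun t ht => ⟨by
      rw [cutDown_eq_zero ha (by linarith [norm_nonneg b])]; exact hz _, by
      rw [cutDown_eq_zero hb (by linarith [norm_nonneg a])]; exact hz _⟩⟩ h
  exact ⟨s, hs0, hsr, hs⟩

lemma exists_close_of_dW_lt (hA : PropertyI A) {a b : A} (ha : 0 ≤ a) (hb : 0 ≤ b) {r : ℝ}
    (h : dW a b < r) {ε : ℝ} (hε : 0 < ε) :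
    ∃ b' : A, 0 ≤ b' ∧ ‖a - b'‖ < 4 * r ∧ dU b b' < ε := by
  obtain ⟨s, hs0, hsr, hs⟩ := exists_cuntzLE_of_dW_lt ha hb h
  exact exists_close_of_cutDownLE hA ha hb hs0 hsr
    (cutDownLE_of_cuntzLE _ (.of_nonneg hb) (.of_nonneg ha) hs0 fun t ht => (hs t ht).1)
    (cutDownLE_of_cuntzLE _ (.of_nonneg ha) (.of_nonneg hb) hs0 fun t ht => (hs t ht).2) hε

/-- Two orbit points at distance below `r` become, after both unitaries are moved to one side, a
norm estimate between a conjugate of one element and the other; this gives the comparison in both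
directions. -/
lemma exists_close_of_dU_lt (hA : PropertyI A) {a b : A} (ha : 0 ≤ a) (hb : 0 ≤ b) {r : ℝ}
    (h : dU a b < r) {ε : ℝ} (hε : 0 < ε) :
    ∃ b' : A, 0 ≤ b' ∧ ‖a - b'‖ < 4 * r ∧ dU b b' < ε := by
  let _ := CStarAlgebra.spectralOrder (Unitization ℂ (Stabilization A))
  have := CStarAlgebra.spectralOrderedRing (Unitization ℂ (Stabilization A))
  obtain ⟨_, ⟨v, rfl⟩, _, ⟨w, rfl⟩, hvw⟩ := exists_lt_of_dU_lt h
  have hsa : IsSelfAdjoint (stableHom A a) := (IsSelfAdjoint.of_nonneg ha).map _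
  have hsb : IsSelfAdjoint (stableHom A b) := (IsSelfAdjoint.of_nonneg hb).map _
  have key : ∀ (c d : Unitization ℂ (Stabilization A)) (p q : StableUnitary A),
      ‖((star q * p : StableUnitary A) : Unitization ℂ (Stabilization A)) * c *
        star ((star q * p : StableUnitary A) : Unitization ℂ (Stabilization A)) - d‖ =
      ‖(p : Unitization ℂ (Stabilization A)) * c * star (p : Unitization ℂ (Stabilization A)) -
        q * d * star (q : Unitization ℂ (Stabilization A))‖ := fun c d p q => by
    have hq' : (q : Unitization ℂ (Stabilization A)) *
        star (q : Unitization ℂ (Stabilization A)) = 1 := Unitary.mul_star_self_of_mem q.2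
    have hq : ∀ m, (q : Unitization ℂ (Stabilization A)) *
        (star (q : Unitization ℂ (Stabilization A)) * m) = m := fun m => by
      rw [← mul_assoc, hq', one_mul]
    rw [← CStarRing.norm_coe_unitary_mul q, ← CStarRing.norm_mul_coe_unitary (_ * _) (star q)]
    congr 1
    simp only [Submonoid.coe_mul, Unitary.coe_star, star_mul, star_star, mul_sub, sub_mul,
      mul_assoc, hq, hq', mul_one]
  refine exists_close_of_cutDownLE hA ha hb (norm_nonneg _) hvw
    (cutDownLE_of_norm_conj_sub_le hsb hsa (star v * w).2 ?_)
    (cutDownLE_of_norm_conj_sub_le hsa hsb (star w * v).2 ?_) hε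
  · rw [key, norm_sub_rev]; rfl
  · rw [key]; rfl

lemma dU_le_norm_sub (a b : A) : dU a b ≤ ‖a - b‖ := by
  refine (dU_le (toStable_mem_stableOrbit a) (toStable_mem_stableOrbit b)).trans (le_of_eq ?_)
  rw [← stableHom_apply, ← stableHom_apply, ← map_sub]
  exact NonUnitalStarAlgHom.norm_map _
    (Unitization.inr_injective.comp Stabilization.cornerHom_injective) _

/-- A controlled `dU`-Cauchy sequence `a n` is shadowed by elements `p n` of `A` with `dU (a n) (p
n) < 2⁻ⁿ` whose consecutive norm distances are summable. Their norm limit is a `dU`-limit, because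
`dU` is at most the norm distance. -/
lemma completeSpace_positiveElements (hA : PropertyI A) : CompleteSpace (PositiveElements A) := by
  refine Metric.complete_of_convergent_controlled_sequences (fun n => (1 / 2 : ℝ) ^ n)
    (fun n => by positivity) fun a ha => ?_
  have step : ∀ (n : ℕ) (p : {p : A // 0 ≤ p ∧ dU (a n).1 p < (1 / 2 : ℝ) ^ n}),
      ∃ q : {q : A // 0 ≤ q ∧ dU (a (n + 1)).1 q < (1 / 2 : ℝ) ^ (n + 1)},
        ‖p.1 - q.1‖ < 8 * (1 / 2 : ℝ) ^ n := by
    intro n p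
    have h1 : dU (a n).1 (a (n + 1)).1 < (1 / 2 : ℝ) ^ n := ha n n (n + 1) le_rfl n.le_succ
    -- The factor 2 here and the factor 4 of the approximation lemma give the 8.
    have h2 : dU p.1 (a (n + 1)).1 < 2 * (1 / 2 : ℝ) ^ n := by
      have := dU_triangle p.1 (a n).1 (a (n + 1)).1
      rw [dU_comm p.1 (a n).1] at this
      linarith [p.2.2]
    obtain ⟨q, hq, h3, h4⟩ := exists_close_of_dU_lt hA p.2.1 (a (n + 1)).2 h2
      (show (0 : ℝ) < (1 / 2) ^ (n + 1) by positivity)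
    exact ⟨⟨q, hq, h4⟩, by linarith⟩
  choose F hF using step
  let p : ∀ n, {p : A // 0 ≤ p ∧ dU (a n).1 p < (1 / 2 : ℝ) ^ n} := fun n =>
    Nat.rec ⟨(a 0).1, (a 0).2, by rw [dU_self]; positivity⟩ F n
  have hp : ∀ n, dist (p n).1 (p (n + 1)).1 ≤ 8 * (1 / 2 : ℝ) ^ n := fun n => by
    rw [dist_eq_norm]; exact (hF n (p n)).le
  obtain ⟨l, hl⟩ := cauchySeq_tendsto_of_complete
    (cauchySeq_of_le_geometric (1 / 2) 8 (by norm_num) hp)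
  have hl0 : 0 ≤ l := CStarAlgebra.isClosed_nonneg.mem_of_tendsto hl
    (Eventually.of_forall fun n => (p n).2.1)
  refine ⟨⟨l, hl0⟩, tendsto_iff_dist_tendsto_zero.mpr ?_⟩
  have h1 := (tendsto_pow_atTop_nhds_zero_of_lt_one (r := (1 / 2 : ℝ)) (by norm_num)
    (by norm_num)).add (tendsto_iff_norm_sub_tendsto_zero.mp hl)
  rw [add_zero] at h1
  refine squeeze_zero (fun _ => dist_nonneg) (fun n => ?_) h1
  exact (dU_triangle (a n).1 (p n).1 l).trans
    (add_le_add (p n).2.2.le (dU_le_norm_sub _ _))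

end Stable

end CStarStab

theorem mainTheorem8 {A : Type u} [NonUnitalCStarAlgebra A] [PartialOrder A] [StarOrderedRing A]
    (hA : CStarStab.PropertyI A) :
    (∀ (a b : A) (r : ℝ), 0 ≤ a → 0 ≤ b → CStarStab.dW a b < r →
      ∀ ε : ℝ, 0 < ε → ∃ b' : A, 0 ≤ b' ∧ ‖a - b'‖ < 4 * r ∧ CStarStab.dU b b' < ε) ∧
    CompleteSpace (CStarStab.PositiveElements A) :=
  ⟨fun _ _ _ ha hb h _ hε => CStarStab.exists_close_of_dW_lt hA ha hb h hε,
    CStarStab.completeSpace_positiveElements hA⟩
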